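/- \textbf{Theorem (Poisson energy as a smooth quadratic proxy of variance).} Let $R\subset\mathbb R^2$ be a bounded Lipschitz domain (nonempty, open, connected, bounded, and near each boundary point equal, after a rigid motion, to the region above the graph of a Lipschitz function). Let $L^2_0(R)=\{f\in L^2(R):\int_R f\,dx=0\}$, and let $-\Delta_N$ be the Neumann Laplacian, i.e. the operator on $L^2(R)$ associated with the form $\int_R|\nabla u|^2\,dx$ on $H^1(R)$: $-\Delta_N u=f$ means $u\in H^1(R)$, $f\in L^2(R)$ and $\int_R\nabla u\cdot\nabla v\,dx=\int_R f\,v\,dx$ for all $v\in H^1(R)$. Then the following hold. (1) For every $r\in L^2_0(R)$ there is exactly one weak solution $\phi=\phi_r\in H^1(R)$ of the Neumann problem $-\Delta\phi=r$ in $R$, $\nabla\phi\cdot\mathbf n=0$ on $\partial R$, $\int_R\phi\,dx=0$. The restriction of $-\Delta_N$ to the functions of mean zero in its domain is a bijection onto $L^2_0(R)$; its inverse $G=(-\Delta_N)^{-1}:L^2_0(R)\to L^2_0(R)$ is the Neumann Green operator. (2) For every $r\in L^2_0(R)$ we have $\phi_r=Gr$, and the Poisson energy $E(r):=\frac12\int_R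 r\,\phi_r\,dx$ equals $\frac12\langle r,Gr\rangle_{L^2(R)}$. In particular, consider a floorplan consisting of $n\ge 0$ axis-parallel rectangular modules $M_i\subset\overline R$ with positive side lengths, areas $A_i$ and centres $c_i$; let $\rho(\cdot;c)=\sum_i \mathbf 1_{M_i}$, $\bar\rho=\frac1{|R|}\sum_i A_i$ and $r(\cdot;c)=\rho(\cdot;c)-\bar\rho$. Then $r(\cdot;c)\in L^2_0(R)$, and with $\phi=\phi_{r(\cdot;c)}$, \[E(c):=\tfrac12\int_R\phi(x)\,r(x;c)\,dx=\tfrac12\langle r(\cdot;c),G\,r(\cdot;c)\rangle_{L^2(R)},\qquad \phi=G\,r(\cdot;c).\] (3) $E$ is a positive definite quadratic form on $L^2_0(R)$ and is strictly convex there. (4) $E$ is Fr\'echet differentiable on $L^2_0(R)$ and its first variation is $\frac{\delta E}{\delta r}=\phi_r=Gr$, that is, $DE(r)[\eta]=\int_R\phi_r\,\eta\,dx$ for all $r,\eta\in L^2_0(R)$. Moreover $Gr$ is smoother than $r$: there is a constant $C$ depending only on $R$ such that $\|Gr\|_{L^2(R)}+\|\nabla Gr\|_{L^2(R)}\le C\,\|r\|_{L^2(R)}$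 for all $r\in L^2_0(R)$. -/

import Mathlib

open MeasureTheory Set
open scoped NNReal ContDiff

noncomputable section

namespace PoissonEnergy

abbrev Plane : Type := EuclideanSpace ℝ (Fin 2)

/-- A bounded Lipschitz domain in the plane: a nonempty, connected, bounded open set which near
each boundary point is, after a rigid motion, the region above the graph of a Lipschitz function. -/
structure IsBoundedLipschitzDomain (R : Set Plane) : Prop where
  isOpen : IsOpen R
  isConnected : IsConnected R
  isBounded : Bornology.IsBounded R
  exists_graph : ∀ p ∈ frontier R, ∃ (δ : ℝ) (e : Plane ≃ᵃⁱ[ℝ] Plane) (K : ℝ≥0) (γ : ℝ → ℝ),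
    0 < δ ∧ LipschitzWith K γ ∧ ∀ x ∈ Metric.ball p δ, x ∈ R ↔ γ (e x 0) < e x 1

/-- The real Hilbert space `L²(R)`. -/
abbrev L2 (R : Set Plane) : Type := Lp ℝ 2 (volume.restrict R)

/-- Square integrable vector fields on `R`. -/
abbrev L2Vec (R : Set Plane) : Type := Lp Plane 2 (volume.restrict R)

/-- `L²₀(R)`, the functions in `L²(R)` of integral zero. (On a bounded `R` integrability is
automatic; it is listed so that the definition makes sense for every `R`.) -/
def L20 (R : Set Plane) : Submodule ℝ (L2 R) where
  carrier := {f | Integrable f (volume.restrict R) ∧ ∫ x in R, f x = 0}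
  zero_mem' := by
    refine ⟨(integrable_congr (Lp.coeFn_zero ℝ 2 (volume.restrict R))).2
      (integrable_zero _ _ _), ?_⟩
    rw [integral_congr_ae (Lp.coeFn_zero ℝ 2 (volume.restrict R))]
    simp
  add_mem' := by
    rintro f g ⟨hf, hf0⟩ ⟨hg, hg0⟩
    refine ⟨(integrable_congr (Lp.coeFn_add f g)).2 (hf.add hg), ?_⟩
    rw [integral_congr_ae (Lp.coeFn_add f g)]
    simp only [Pi.add_apply]
    rw [integral_add hf hg, hf0, hg0, add_zero]
  smul_mem' := by
    rintro a f ⟨hf, hf0⟩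
    refine ⟨(integrable_congr (Lp.coeFn_smul a f)).2 (hf.smul a), ?_⟩
    rw [integral_congr_ae (Lp.coeFn_smul a f)]
    simp only [Pi.smul_apply]
    rw [integral_smul, hf0, smul_zero]

/-- `g` is the weak gradient of `u` on `R`; `H¹(R)` consists of the `u : L2 R` which have some
weak gradient `g : L2Vec R`. -/
def IsWeakGradient (R : Set Plane) (u : L2 R) (g : L2Vec R) : Prop :=
  ∀ ψ : Plane → ℝ, ContDiff ℝ ∞ ψ → HasCompactSupport ψ → tsupport ψ ⊆ R →
    ∫ x in R, u x • gradient ψ x = -∫ x in R, ψ x • g x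

lemma integrable_smul_gradient {R : Set Plane} (u : L2 R) {ψ : Plane → ℝ}
    (hψ : ContDiff ℝ ∞ ψ) (hc : HasCompactSupport ψ) :
    Integrable (fun x => u x • gradient ψ x) (volume.restrict R) := by
  have hcont : Continuous (gradient ψ) :=
    (InnerProductSpace.toDual ℝ Plane).symm.continuous.comp (hψ.continuous_fderiv (by simp))
  have hcs : HasCompactSupport (gradient ψ) :=
    (hc.fderiv ℝ).comp_left (g := (InnerProductSpace.toDual ℝ Plane).symm) (map_zero _)
  exact memLp_one_iff_integrable.1
    ((hcont.memLp_of_hasCompactSupport (p := 2) hcs).smul (Lp.memLp u))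

lemma integrable_smul_field {R : Set Plane} (g : L2Vec R) {ψ : Plane → ℝ}
    (hψ : ContDiff ℝ ∞ ψ) (hc : HasCompactSupport ψ) :
    Integrable (fun x => ψ x • g x) (volume.restrict R) :=
  memLp_one_iff_integrable.1
    ((Lp.memLp g).smul (hψ.continuous.memLp_of_hasCompactSupport (p := 2) hc))

lemma IsWeakGradient.zero (R : Set Plane) : IsWeakGradient R 0 0 := by
  intro ψ _ _ _
  have h1 : (fun x => (0 : L2 R) x • gradient ψ x) =ᵐ[volume.restrict R] fun _ => 0 := by
    filter_upwards [Lp.coeFn_zero ℝ 2 (volume.restrict R)] with x hx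
    rw [hx]; simp
  have h2 : (fun x => ψ x • (0 : L2Vec R) x) =ᵐ[volume.restrict R] fun _ => 0 := by
    filter_upwards [Lp.coeFn_zero Plane 2 (volume.restrict R)] with x hx
    rw [hx]; simp
  rw [integral_congr_ae h1, integral_congr_ae h2]
  simp

lemma IsWeakGradient.add {R : Set Plane} {u v : L2 R} {g h : L2Vec R}
    (hu : IsWeakGradient R u g) (hv : IsWeakGradient R v h) :
    IsWeakGradient R (u + v) (g + h) := by
  intro ψ hψ hc hs
  have h1 : (fun x => (u + v) x • gradient ψ x) =ᵐ[volume.restrict R]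
      fun x => u x • gradient ψ x + v x • gradient ψ x := by
    filter_upwards [Lp.coeFn_add u v] with x hx
    rw [hx, Pi.add_apply, add_smul]
  have h2 : (fun x => ψ x • (g + h) x) =ᵐ[volume.restrict R]
      fun x => ψ x • g x + ψ x • h x := by
    filter_upwards [Lp.coeFn_add g h] with x hx
    rw [hx, Pi.add_apply, smul_add]
  rw [integral_congr_ae h1, integral_congr_ae h2,
    integral_add (integrable_smul_gradient u hψ hc) (integrable_smul_gradient v hψ hc),
    integral_add (integrable_smul_field g hψ hc) (integrable_smul_field h hψ hc),
    hu ψ hψ hc hs, hv ψ hψ hc hs, neg_add]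

lemma IsWeakGradient.smul {R : Set Plane} {u : L2 R} {g : L2Vec R} (a : ℝ)
    (hu : IsWeakGradient R u g) : IsWeakGradient R (a • u) (a • g) := by
  intro ψ hψ hc hs
  have h1 : (fun x => (a • u) x • gradient ψ x) =ᵐ[volume.restrict R]
      fun x => a • (u x • gradient ψ x) := by
    filter_upwards [Lp.coeFn_smul a u] with x hx
    rw [hx, Pi.smul_apply, smul_assoc]
  have h2 : (fun x => ψ x • (a • g) x) =ᵐ[volume.restrict R] fun x => a • (ψ x • g x) := by
    filter_upwards [Lp.coeFn_smul a g] with x hx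
    rw [hx, Pi.smul_apply, smul_comm]
  rw [integral_congr_ae h1, integral_congr_ae h2, integral_smul, integral_smul,
    hu ψ hψ hc hs, smul_neg]

/-- The graph of the Neumann Laplacian: the pairs `(u, f)` with `u ∈ H¹(R)`, `f ∈ L²(R)` and
`∫ ∇u · ∇v = ∫ f v` for all `v ∈ H¹(R)`. -/
def neumannGraph (R : Set Plane) : Submodule ℝ (L2 R × L2 R) where
  carrier := {p | ∃ g : L2Vec R, IsWeakGradient R p.1 g ∧
    ∀ (v : L2 R) (h : L2Vec R), IsWeakGradient R v h → inner ℝ g h = inner ℝ p.2 v}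
  zero_mem' := ⟨0, IsWeakGradient.zero R, fun v h _ => by simp⟩
  add_mem' := by
    rintro p q ⟨g, hg, hp⟩ ⟨k, hk, hq⟩
    refine ⟨g + k, hg.add hk, fun v h hv => ?_⟩
    rw [inner_add_left, hp v h hv, hq v h hv, Prod.snd_add, inner_add_left]
  smul_mem' := by
    rintro a p ⟨g, hg, hp⟩
    refine ⟨a • g, hg.smul a, fun v h hv => ?_⟩
    rw [real_inner_smul_left, hp v h hv, Prod.smul_snd, real_inner_smul_left]

/-- The Neumann Laplacian `-Δ_N`, the unbounded operator on `L²(R)` associated with the quadratic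
form `∫ |∇u|²` on `H¹(R)`. -/
def neumannLaplacian (R : Set Plane) : L2 R →ₗ.[ℝ] L2 R := (neumannGraph R).toLinearPMap

/-- The Neumann Green operator `(-Δ_N)⁻¹` as a partially defined operator: the inverse of the
restriction of `-Δ_N` to the functions of integral zero. -/
def neumannGreen (R : Set Plane) : L2 R →ₗ.[ℝ] L2 R :=
  ((neumannLaplacian R).domRestrict (L20 R)).inverse

open Classical in
/-- The values of the Green operator (and `0` outside of its domain). -/
def green (R : Set Plane) (r : L2 R) : L2 R :=
  if h : r ∈ (neumannGreen R).domain then neumannGreen R ⟨r, h⟩ else 0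

/-- `φ` is a weak solution of `-Δφ = r` in `R`, `∂φ/∂n = 0` on `∂R`, `∫_R φ = 0`. -/
def IsNeumannPotential (R : Set Plane) (r : Plane → ℝ) (φ : L2 R) : Prop :=
  φ ∈ L20 R ∧ ∃ g : L2Vec R, IsWeakGradient R φ g ∧
    ∀ (v : L2 R) (h : L2Vec R), IsWeakGradient R v h →
      ∫ x in R, inner ℝ (g x) (h x) = ∫ x in R, r x * v x

open Classical in
/-- The potential of `r`, the weak solution of the Neumann problem (`0` if there is none). -/
def potential (R : Set Plane) (r : Plane → ℝ) : L2 R :=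
  if h : ∃ φ, IsNeumannPotential R r φ then h.choose else 0

/-- The Poisson energy `½ ∫_R r φ` of a residual density `r` with potential `φ`. -/
def energy (R : Set Plane) (r : Plane → ℝ) : ℝ :=
  (1 / 2) * ∫ x in R, r x * potential R r x

/-- The axis-parallel rectangle with centre `c` and side lengths `s 0` and `s 1`. -/
def box (s : Fin 2 → ℝ) (c : Plane) : Set Plane := {x | ∀ k, |x k - c k| ≤ s k / 2}

/-- The aggregate density of the modules with side lengths `s i` centred at `c i`. -/
def density {n : ℕ} (s : Fin n → Fin 2 → ℝ) (c : Fin n → Plane) (x : Plane) : ℝ :=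
  ∑ i, (box (s i) (c i)).indicator (fun _ => (1 : ℝ)) x

/-- The average density, the total module area divided by the area of `R`. -/
def meanDensity (R : Set Plane) {n : ℕ} (s : Fin n → Fin 2 → ℝ) : ℝ :=
  1 / volume.real R * ∑ i, s i 0 * s i 1

/-- The residual density of a floorplan. -/
def residual (R : Set Plane) {n : ℕ} (s : Fin n → Fin 2 → ℝ) (c : Fin n → Plane)
    (x : Plane) : ℝ :=
  density s c x - meanDensity R s

/-- The Poisson energy of a floorplan. -/
def floorplanEnergy (R : Set Plane) {n : ℕ} (s : Fin n → Fin 2 → ℝ) (c : Fin n → Plane) : ℝ :=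
  energy R (residual R s c)

end PoissonEnergy

end

namespace PoissonEnergy

/-! Everything rests on the Poincaré inequality on `R`. Granted it, the Dirichlet form is coercive
on the mean-zero part of `H¹(R)`, and Lax–Milgram (`exists_solution_operator`) gives bounded
operators `G` and `A` with `A r` the weak gradient of `G r`. Since `⟨r, G q⟩ = ⟨A r, A q⟩`, the form
`⟨r, G q⟩` is symmetric, and it is positive definite because `A r = 0` makes `r` orthogonal to the
dense subspace `H¹(R)`. The energy is half the diagonal of this bounded form, which yields convexity
and the first variation; the smoothing estimate is the boundedness of `G` and `A`.

The Poincaré inequality is obtained by localisation. On a piece star-shaped with respect to a ball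
it follows by integrating the gradient along segments ending in the ball, with mollification on
slightly shrunken copies of the piece to pass from smooth functions to weak gradients. A Lipschitz
domain is locally of this kind: near a boundary point, a strip above the graph is star-shaped with
respect to every point lying high enough (`starConvex_epigraphStrip`). Compactness of the closure
leaves finitely many pieces, and connectedness lets them be glued along overlaps of positive measure
(`PoincareOn.union`, `poincareOn_of_cover`).

The unbounded operators are handled through their graphs. Uniqueness of weak gradients and density
of `H¹(R)` make the graph of the Neumann Laplacian single-valued; uniqueness of solutions makes its
mean-zero restriction injective, with inverse `G` on `L²₀(R)`. -/

/-! ### Poincaré inequality for smooth functions on star-shaped domains. -/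

lemma sq_lintegral_le {α : Type*} [MeasurableSpace α] (μ : Measure α) {f : α → ENNReal}
    (hf : AEMeasurable f μ) : (∫⁻ a, f a ∂μ) ^ 2 ≤ μ univ * ∫⁻ a, f a ^ 2 ∂μ := by
  have h := ENNReal.lintegral_mul_le_Lp_mul_Lq μ Real.HolderConjugate.two_two hf
    (aemeasurable_const (b := (1 : ENNReal)))
  simp only [Pi.mul_apply, mul_one, lintegral_one, ENNReal.rpow_two, one_pow] at h
  calc (∫⁻ a, f a ∂μ) ^ 2
      ≤ ((∫⁻ a, f a ^ 2 ∂μ) ^ (1 / 2 : ℝ) * μ univ ^ (1 / 2 : ℝ)) ^ 2 := by gcongr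
    _ = μ univ * ∫⁻ a, f a ^ 2 ∂μ := by
      rw [mul_pow, ← ENNReal.rpow_two, ← ENNReal.rpow_two, ← ENNReal.rpow_mul, ← ENNReal.rpow_mul]
      norm_num [mul_comm]

/-- Change of variables `y = w + a x` in the plane: the Jacobian factor is `a⁻²`, at most 4 when `a
≥ 1/2`. -/
lemma setLIntegral_add_smul_le {S V : Set Plane} (hS : MeasurableSet S) (hV : MeasurableSet V)
    {F : Plane → ENNReal} (hF : Measurable F) (w : Plane) {a : ℝ} (ha : 1 / 2 ≤ a)
    (hSV : ∀ x ∈ S, w + a • x ∈ V) :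
    ∫⁻ x in S, F (w + a • x) ≤ 4 * ∫⁻ x in V, F x := by
  have ha0 : a ≠ 0 := by linarith
  have hFV : Measurable (V.indicator F) := hF.indicator hV
  calc ∫⁻ x in S, F (w + a • x)
      ≤ ∫⁻ x, V.indicator F (w + a • x) := by
        rw [← lintegral_indicator hS]
        refine lintegral_mono fun x => ?_
        by_cases hx : x ∈ S
        · simp [hx, hSV x hx]
        · simp [hx]
    _ = ∫⁻ y, V.indicator F (w + y) ∂(Measure.map (fun x : Plane => a • x) volume) := by
        rw [lintegral_map (f := fun y => V.indicator F (w + y)) (by fun_prop) (by fun_prop)]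
    _ = ENNReal.ofReal |(a ^ 2)⁻¹| * ∫⁻ x in V, F x := by
        rw [Measure.map_addHaar_smul volume ha0, lintegral_smul_measure,
          lintegral_add_left_eq_self, lintegral_indicator hV]
        simp
    _ ≤ 4 * ∫⁻ x in V, F x := by
        gcongr
        rw [ENNReal.ofReal_le_iff_le_toReal (by simp), abs_of_nonneg (by positivity)]
        have : (1 / 2 : ℝ) ^ 2 ≤ a ^ 2 := by gcongr
        rw [inv_le_comm₀ (by positivity) (by norm_num)]
        norm_num at this ⊢
        linarith

/-- Fundamental theorem of calculus along the segment from `z` to `x`, then Cauchy–Schwarz on the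
unit interval. -/
lemma enorm_sub_sq_le {v : Plane → ℝ} (hv : ContDiff ℝ 1 v) {D : ℝ≥0} {x z : Plane}
    (hD : ‖x - z‖ ≤ D) :
    ‖v x - v z‖ₑ ^ 2 ≤ (D : ENNReal) ^ 2 *
      ∫⁻ t in Ioc (0 : ℝ) 1, ‖fderiv ℝ v (z + t • (x - z))‖ₑ ^ 2 := by
  have hc : Continuous fun t : ℝ => fderiv ℝ v (z + t • (x - z)) :=
    (hv.continuous_fderiv (by simp)).comp (by fun_prop)
  have hd : ∀ t : ℝ, HasDerivAt (fun t : ℝ => v (z + t • (x - z)))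
      (fderiv ℝ v (z + t • (x - z)) (x - z)) t := by
    intro t
    have h1 : HasDerivAt (fun t : ℝ => z + t • (x - z)) (x - z) t := by
      simpa using ((hasDerivAt_id t).smul_const (x - z)).const_add z
    exact ((hv.differentiable (by simp)) _).hasFDerivAt.comp_hasDerivAt t h1
  have hint := intervalIntegral.integral_eq_sub_of_hasDerivAt (a := 0) (b := 1)
    (fun t _ => hd t) ((hc.clm_apply continuous_const).intervalIntegrable _ _)
  have h1 : v x - v z = ∫ t in (0 : ℝ)..1, fderiv ℝ v (z + t • (x - z)) (x - z) := by
    rw [hint]; simp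
  have h2 : ‖v x - v z‖ₑ ≤ D * ∫⁻ t in Ioc (0 : ℝ) 1, ‖fderiv ℝ v (z + t • (x - z))‖ₑ := by
    rw [h1, intervalIntegral.integral_of_le zero_le_one, ← lintegral_const_mul']
    · refine (enorm_integral_le_lintegral_enorm _).trans (lintegral_mono fun t => ?_)
      refine (ContinuousLinearMap.le_opENorm _ _).trans ?_
      rw [mul_comm]
      gcongr
      rw [enorm_eq_nnnorm, ENNReal.coe_le_coe]
      exact hD
    · simp
  calc ‖v x - v z‖ₑ ^ 2
      ≤ (D * ∫⁻ t in Ioc (0 : ℝ) 1, ‖fderiv ℝ v (z + t • (x - z))‖ₑ) ^ 2 := by gcongr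
    _ ≤ _ := by
      rw [mul_pow]
      gcongr
      refine (sq_lintegral_le _ hc.enorm.aemeasurable).trans ?_
      simp

/-- The Poincaré inequality for smooth functions on a domain which is star-shaped with respect to
every point of `B`. -/
lemma lintegral_lintegral_enorm_sub_sq_le {V B : Set Plane} (hV : IsOpen V) (hB : IsOpen B)
    (hBV : B ⊆ V) (hstar : ∀ z ∈ B, StarConvex ℝ z V) {D : ℝ≥0}
    (hD : ∀ x ∈ V, ∀ z ∈ V, ‖x - z‖ ≤ D) {v : Plane → ℝ} (hv : ContDiff ℝ 1 v) :
    ∫⁻ x in V, ∫⁻ z in B, ‖v x - v z‖ₑ ^ 2 ≤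
      (D : ENNReal) ^ 2 * (4 * volume V * ∫⁻ x in V, ‖fderiv ℝ v x‖ₑ ^ 2) := by
  set F : Plane → ENNReal := fun x => ‖fderiv ℝ v x‖ₑ ^ 2 with hF
  have hFc : Continuous F :=
    (ENNReal.continuous_pow 2).comp (hv.continuous_fderiv (by simp)).enorm
  have hmem : ∀ t ∈ Ioc (0 : ℝ) 1, ∀ z ∈ B, ∀ x ∈ V, z + t • (x - z) ∈ V := by
    intro t ht z hz x hx
    have := hstar z hz hx (sub_nonneg.2 ht.2) ht.1.le (by ring)
    convert this using 1
    module
  have key : ∀ t ∈ Ioc (0 : ℝ) 1, ∫⁻ x in V, ∫⁻ z in B, F (z + t • (x - z)) ≤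
      4 * volume V * ∫⁻ x in V, F x := by
    intro t ht
    -- The point `z + t (x - z)` scales by `t` in `x` and by `1 - t` in `z`. Substituting in
    -- whichever variable has factor at least 1/2 avoids a singular Jacobian at either end.
    rcases le_total (1 / 2) t with h | h
    · have hsw : ∫⁻ x in V, ∫⁻ z in B, F (z + t • (x - z)) =
          ∫⁻ z in B, ∫⁻ x in V, F (z + t • (x - z)) := by
        refine lintegral_lintegral_swap ?_
        exact (hFc.comp (g := F) (f := fun p : Plane × Plane => p.2 + t • (p.1 - p.2))
          (by fun_prop)).aemeasurable
      rw [hsw]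
      calc ∫⁻ z in B, ∫⁻ x in V, F (z + t • (x - z))
          ≤ ∫⁻ z in B, 4 * ∫⁻ x in V, F x := by
            refine setLIntegral_mono' hB.measurableSet fun z hz => ?_
            have := setLIntegral_add_smul_le hV.measurableSet hV.measurableSet hFc.measurable
              ((1 - t) • z) h (fun x hx => by
                convert hmem t ht z hz x hx using 1
                module)
            refine le_trans (le_of_eq ?_) this
            refine lintegral_congr fun x => ?_
            congr 1
            module
        _ ≤ 4 * volume V * ∫⁻ x in V, F x := by
            rw [setLIntegral_const, mul_right_comm]
            gcongr
    · calc ∫⁻ x in V, ∫⁻ z in B, F (z + t • (x - z))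
          ≤ ∫⁻ x in V, 4 * ∫⁻ x in V, F x := by
            refine setLIntegral_mono' hV.measurableSet fun x hx => ?_
            have := setLIntegral_add_smul_le hB.measurableSet hV.measurableSet hFc.measurable
              (t • x) (a := 1 - t) (by linarith) (fun z hz => by
                convert hmem t ht z hz x hx using 1
                module)
            refine le_trans (le_of_eq ?_) this
            refine lintegral_congr fun z => ?_
            congr 1
            module
        _ = 4 * volume V * ∫⁻ x in V, F x := by
            rw [setLIntegral_const, mul_right_comm]
  calc ∫⁻ x in V, ∫⁻ z in B, ‖v x - v z‖ₑ ^ 2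
      ≤ ∫⁻ x in V, ∫⁻ z in B, (D : ENNReal) ^ 2 * ∫⁻ t in Ioc (0 : ℝ) 1, F (z + t • (x - z)) := by
        refine setLIntegral_mono' hV.measurableSet fun x hx => ?_
        refine setLIntegral_mono' hB.measurableSet fun z hz => ?_
        exact enorm_sub_sq_le hv (hD x hx z (hBV hz))
    _ = (D : ENNReal) ^ 2 * ∫⁻ x in V, ∫⁻ z in B, ∫⁻ t in Ioc (0 : ℝ) 1, F (z + t • (x - z)) := by
        rw [← lintegral_const_mul' _ _ (by simp)]
        refine lintegral_congr fun x => ?_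
        rw [← lintegral_const_mul' _ _ (by simp)]
    _ = (D : ENNReal) ^ 2 * ∫⁻ t in Ioc (0 : ℝ) 1, ∫⁻ x in V, ∫⁻ z in B, F (z + t • (x - z)) := by
        have h1 : ∀ x, ∫⁻ z in B, ∫⁻ t in Ioc (0 : ℝ) 1, F (z + t • (x - z)) =
            ∫⁻ t in Ioc (0 : ℝ) 1, ∫⁻ z in B, F (z + t • (x - z)) := fun x =>
          lintegral_lintegral_swap (hFc.comp (g := F)
            (f := fun p : Plane × ℝ => p.1 + p.2 • (x - p.1)) (by fun_prop)).aemeasurable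
        simp_rw [h1]
        rw [lintegral_lintegral_swap]
        refine Measurable.aemeasurable ?_
        exact Measurable.lintegral_prod_right' (f := fun q : (Plane × ℝ) × Plane =>
          F (q.2 + q.1.2 • (q.1.1 - q.2))) (hFc.comp (by fun_prop)).measurable
    _ ≤ (D : ENNReal) ^ 2 * ∫⁻ t in Ioc (0 : ℝ) 1, 4 * volume V * ∫⁻ x in V, F x := by
        gcongr 1
        exact setLIntegral_mono' measurableSet_Ioc key
    _ = _ := by rw [setLIntegral_const]; simp

/-! ### Mollification and weak gradients. -/

open Filter Topology Convolution

lemma memLp_indicator_coe {F : Type*} [NormedAddCommGroup F] {R : Set Plane}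
    (hR : MeasurableSet R) (f : Lp F 2 (volume.restrict R)) :
    MemLp (R.indicator f) 2 volume :=
  (memLp_indicator_iff_restrict hR).2 (Lp.memLp f)

/-- The mollification of `u`, extended by zero outside of `R`. -/
noncomputable def mollify (R : Set Plane) (η : ContDiffBump (0 : Plane)) (u : L2 R) : Plane → ℝ :=
  η.normed volume ⋆[ContinuousLinearMap.lsmul ℝ ℝ, volume] (R.indicator u)

lemma locallyIntegrable_indicator_coe {F : Type*} [NormedAddCommGroup F] {R : Set Plane}
    (hR : MeasurableSet R) (f : Lp F 2 (volume.restrict R)) :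
    LocallyIntegrable (R.indicator f) volume :=
  (memLp_indicator_coe hR f).locallyIntegrable (by norm_num)

lemma contDiff_mollify {R : Set Plane} (hR : MeasurableSet R) (η : ContDiffBump (0 : Plane))
    (u : L2 R) : ContDiff ℝ 1 (mollify R η u) :=
  η.hasCompactSupport_normed.contDiff_convolution_left _ η.contDiff_normed
    (locallyIntegrable_indicator_coe hR u)

lemma tsupport_normed_sub_subset (η : ContDiffBump (0 : Plane)) (x : Plane) :
    tsupport (fun y => η.normed volume (x - y)) ⊆ Metric.closedBall x η.rOut := by
  refine closure_minimal (fun y hy => ?_) Metric.isClosed_closedBall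
  have : x - y ∈ Function.support (η.normed volume) := hy
  rw [η.support_normed_eq, Metric.mem_ball, dist_zero_right] at this
  rw [Metric.mem_closedBall, dist_comm, dist_eq_norm]
  exact this.le

/-- When the closed ball lies in `R`, the reflected bump `y ↦ η (x - y)` is an admissible test
function, so differentiation passes onto the weak gradient. The sign from the reflection cancels the
one from integration by parts. -/
lemma fderiv_mollify {R : Set Plane} (hR : IsOpen R) {u : L2 R} {g : L2Vec R}
    (hu : IsWeakGradient R u g) (η : ContDiffBump (0 : Plane)) {x : Plane}
    (hx : Metric.closedBall x η.rOut ⊆ R) (w : Plane) :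
    fderiv ℝ (mollify R η u) x w =
      inner ℝ (∫ t, η.normed volume t • R.indicator g (x - t)) w := by
  set ψ : Plane → ℝ := fun y => η.normed volume (x - y) with hψ
  have hψs : ContDiff ℝ ∞ ψ := η.contDiff_normed.comp (contDiff_const.sub contDiff_id)
  have hψc : HasCompactSupport ψ :=
    HasCompactSupport.of_support_subset_isCompact (isCompact_closedBall x η.rOut)
      (subset_closure.trans (tsupport_normed_sub_subset η x))
  have hgrad : ∀ y, gradient ψ y = -gradient (η.normed volume) (x - y) := by
    intro y
    have h1 : HasFDerivAt ψ ((fderiv ℝ (η.normed volume) (x - y)).comp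
        (-ContinuousLinearMap.id ℝ Plane)) y :=
      HasFDerivAt.comp y ((η.contDiff_normed (n := 1)).differentiable (by simp) _).hasFDerivAt
        ((hasFDerivAt_id y).const_sub x)
    rw [gradient, gradient, h1.fderiv, ContinuousLinearMap.comp_neg,
      ContinuousLinearMap.comp_id, map_neg]
  have hwk := hu ψ hψs hψc ((tsupport_normed_sub_subset η x).trans hx)
  have hL := η.hasCompactSupport_normed.hasFDerivAt_convolution_left
    (ContinuousLinearMap.lsmul ℝ ℝ) (η.contDiff_normed (μ := volume))
    (locallyIntegrable_indicator_coe hR.measurableSet u) x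
  have e1 : fderiv ℝ (mollify R η u) x w =
      ∫ y, R.indicator u y * fderiv ℝ (η.normed volume) (x - y) w := by
    rw [mollify, hL.fderiv, convolution_def, ContinuousLinearMap.integral_apply,
      ← integral_sub_left_eq_self _ volume x]
    · refine integral_congr_ae (.of_forall fun y => ?_)
      simp [mul_comm]
    · exact (η.hasCompactSupport_normed.fderiv ℝ).convolutionExists_left _
        ((η.contDiff_normed (n := 1)).continuous_fderiv (by simp))
        (locallyIntegrable_indicator_coe hR.measurableSet u) x
  have e2 : ∫ y, R.indicator u y * fderiv ℝ (η.normed volume) (x - y) w =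
      - inner ℝ (∫ y in R, u y • gradient ψ y) w := by
    rw [real_inner_comm, ← integral_inner (integrable_smul_gradient u hψs hψc),
      ← integral_neg, ← integral_indicator hR.measurableSet]
    refine integral_congr_ae (.of_forall fun y => ?_)
    by_cases hy : y ∈ R
    · simp only [hy, indicator_of_mem]
      rw [hgrad, real_inner_smul_right, inner_neg_right, real_inner_comm, gradient,
        InnerProductSpace.toDual_symm_apply]
      ring
    · simp [hy]
  have e3 : ∫ t, η.normed volume t • R.indicator g (x - t) = ∫ y in R, ψ y • g y := by
    rw [← integral_sub_left_eq_self _ volume x, ← integral_indicator hR.measurableSet]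
    refine integral_congr_ae (.of_forall fun y => ?_)
    by_cases hy : y ∈ R <;> simp [hy, hψ]
  rw [e1, e2, e3, hwk, inner_neg_left, neg_neg]

/-- Jensen's inequality for the square, in the form of Cauchy–Schwarz for the probability measure
with density the normalised bump. -/
lemma enorm_fderiv_mollify_sq_le {R : Set Plane} (hR : IsOpen R) {u : L2 R} {g : L2Vec R}
    (hu : IsWeakGradient R u g) (η : ContDiffBump (0 : Plane)) {x : Plane}
    (hx : Metric.closedBall x η.rOut ⊆ R) :
    ‖fderiv ℝ (mollify R η u) x‖ₑ ^ 2 ≤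
      ∫⁻ t, ENNReal.ofReal (η.normed volume t) * ‖R.indicator g (x - t)‖ₑ ^ 2 := by
  have hηm : Measurable fun t => ENNReal.ofReal (η.normed volume t) :=
    ENNReal.measurable_ofReal.comp (η.contDiff_normed (n := 0)).continuous.measurable
  have hgm : AEStronglyMeasurable (R.indicator g) (volume : Measure Plane) :=
    (memLp_indicator_coe hR.measurableSet g).1
  have hgx : AEMeasurable (fun t => ‖R.indicator g (x - t)‖ₑ) (volume : Measure Plane) :=
    (hgm.comp_quasiMeasurePreserving
      (Measure.measurePreserving_sub_left volume x).quasiMeasurePreserving).enorm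
  set ν : Measure Plane := volume.withDensity fun t => ENNReal.ofReal (η.normed volume t) with hν
  have hν1 : ν univ = 1 := by
    rw [hν, withDensity_apply _ MeasurableSet.univ, Measure.restrict_univ,
      ← ofReal_integral_eq_lintegral_ofReal η.integrable_normed
        (.of_forall η.nonneg_normed), η.integral_normed, ENNReal.ofReal_one]
  have h1 : ‖fderiv ℝ (mollify R η u) x‖ₑ ≤ ∫⁻ t, ‖R.indicator g (x - t)‖ₑ ∂ν := by
    have h2 : ‖fderiv ℝ (mollify R η u) x‖ₑ ≤
        ‖∫ t, η.normed volume t • R.indicator g (x - t)‖ₑ := by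
      rw [enorm_le_iff_norm_le]
      refine ContinuousLinearMap.opNorm_le_bound _ (norm_nonneg _) fun w => ?_
      rw [fderiv_mollify hR hu η hx]
      exact norm_inner_le_norm _ _
    refine h2.trans ((enorm_integral_le_lintegral_enorm _).trans (le_of_eq ?_))
    rw [hν, lintegral_withDensity_eq_lintegral_mul₀ hηm.aemeasurable hgx]
    refine lintegral_congr fun t => ?_
    rw [enorm_smul, Pi.mul_apply, Real.enorm_eq_ofReal (η.nonneg_normed t)]
  calc ‖fderiv ℝ (mollify R η u) x‖ₑ ^ 2 ≤ (∫⁻ t, ‖R.indicator g (x - t)‖ₑ ∂ν) ^ 2 := by gcongr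
    _ ≤ ν univ * ∫⁻ t, ‖R.indicator g (x - t)‖ₑ ^ 2 ∂ν :=
      sq_lintegral_le ν (hgx.mono_ac (withDensity_absolutelyContinuous _ _))
    _ = _ := by
      rw [hν1, one_mul, hν, lintegral_withDensity_eq_lintegral_mul₀ hηm.aemeasurable
        (hgx.pow_const 2)]
      rfl

/-- By Tonelli and translation invariance, averaging over translates does not increase the `L²`
norm. -/
lemma setLIntegral_enorm_fderiv_mollify_sq_le {R V : Set Plane} (hR : IsOpen R)
    (hV : MeasurableSet V) {u : L2 R} {g : L2Vec R}
    (hu : IsWeakGradient R u g) (η : ContDiffBump (0 : Plane))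
    (hVR : ∀ x ∈ V, Metric.closedBall x η.rOut ⊆ R) :
    ∫⁻ x in V, ‖fderiv ℝ (mollify R η u) x‖ₑ ^ 2 ≤ ∫⁻ x in R, ‖g x‖ₑ ^ 2 := by
  have hηm : Measurable fun t => ENNReal.ofReal (η.normed volume t) :=
    ENNReal.measurable_ofReal.comp (η.contDiff_normed (n := 0)).continuous.measurable
  have hgm : AEStronglyMeasurable (R.indicator g) (volume : Measure Plane) :=
    (memLp_indicator_coe hR.measurableSet g).1
  have hg2 : AEMeasurable (fun p : Plane × Plane => ‖R.indicator g (p.1 - p.2)‖ₑ)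
      ((volume : Measure Plane).prod volume) :=
    (hgm.comp_quasiMeasurePreserving
      (quasiMeasurePreserving_sub volume volume)).enorm
  calc ∫⁻ x in V, ‖fderiv ℝ (mollify R η u) x‖ₑ ^ 2
      ≤ ∫⁻ x in V, ∫⁻ t, ENNReal.ofReal (η.normed volume t) * ‖R.indicator g (x - t)‖ₑ ^ 2 :=
        setLIntegral_mono' hV fun x hx => enorm_fderiv_mollify_sq_le hR hu η (hVR x hx)
    _ ≤ ∫⁻ x, ∫⁻ t, ENNReal.ofReal (η.normed volume t) * ‖R.indicator g (x - t)‖ₑ ^ 2 :=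
        setLIntegral_le_lintegral _ _
    _ = ∫⁻ t, ∫⁻ x, ENNReal.ofReal (η.normed volume t) * ‖R.indicator g (x - t)‖ₑ ^ 2 :=
        lintegral_lintegral_swap ((hηm.comp measurable_snd).aemeasurable.mul (hg2.pow_const 2))
    _ = ∫⁻ t, ENNReal.ofReal (η.normed volume t) * ∫⁻ x, ‖R.indicator g x‖ₑ ^ 2 := by
        refine lintegral_congr fun t => ?_
        rw [lintegral_const_mul' _ _ ENNReal.ofReal_ne_top]
        congr 1
        exact lintegral_sub_right_eq_self (fun x => ‖R.indicator g x‖ₑ ^ 2) t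
    _ = ∫⁻ x, ‖R.indicator g x‖ₑ ^ 2 := by
        rw [lintegral_mul_const _ hηm, ← ofReal_integral_eq_lintegral_ofReal η.integrable_normed
          (.of_forall η.nonneg_normed), η.integral_normed, ENNReal.ofReal_one, one_mul]
    _ = ∫⁻ x in R, ‖g x‖ₑ ^ 2 := by
        rw [← lintegral_indicator hR.measurableSet]
        refine lintegral_congr fun x => ?_
        by_cases hx : x ∈ R <;> simp [hx]

/-! ### Poincaré inequality for weak gradients: star-shaped pieces and gluing. -/

/-- The Poincaré inequality on `U ⊆ R`, with the gradient measured on the whole of `R`. -/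
def PoincareOn (R U : Set Plane) : Prop :=
  ∃ C : ℝ≥0, ∀ (u : L2 R) (g : L2Vec R), IsWeakGradient R u g →
    ∃ c : ℝ, eLpNorm (fun x => u x - c) 2 (volume.restrict U) ≤ C * ‖g‖ₑ

lemma eLpNorm_two_sq {F : Type*} [NormedAddCommGroup F] {α : Type*} [MeasurableSpace α]
    (μ : Measure α) (f : α → F) : eLpNorm f 2 μ ^ 2 = ∫⁻ x, ‖f x‖ₑ ^ 2 ∂μ := by
  rw [eLpNorm_eq_lintegral_rpow_enorm_toReal (by simp) (by simp), ← ENNReal.rpow_two,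
    ← ENNReal.rpow_mul]
  simp

lemma lintegral_enorm_coe_sq {F : Type*} [NormedAddCommGroup F] {R : Set Plane}
    (g : Lp F 2 (volume.restrict R)) : ∫⁻ x in R, ‖g x‖ₑ ^ 2 = ‖g‖ₑ ^ 2 := by
  rw [Lp.enorm_def, eLpNorm_two_sq]

/-- The image of `U` under the homothety with centre `z₀` and ratio `1 - s`. -/
def shrink (U : Set Plane) (z₀ : Plane) (s : ℝ) : Set Plane :=
  {x | z₀ + (1 - s)⁻¹ • (x - z₀) ∈ U}

lemma isOpen_shrink {U : Set Plane} (hU : IsOpen U) (z₀ : Plane) (s : ℝ) :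
    IsOpen (shrink U z₀ s) :=
  hU.preimage (by fun_prop)

/-- A point `y` near `x` is the combination, with weights `s` and `1 - s`, of `z₀ + s⁻¹ (y - x)`,
which stays in the ball, and of the preimage of `x` under the homothety, which lies in `U`.
Shrinking thus leaves the room needed for mollification. -/
lemma closedBall_subset_of_mem_shrink {U : Set Plane} {z₀ : Plane} {ρ : ℝ}
    (hstar : ∀ z ∈ Metric.ball z₀ ρ, StarConvex ℝ z U) {s ε : ℝ} (hs : 0 < s) (hs1 : s < 1)
    (hε : ε < s * ρ) {x : Plane} (hx : x ∈ shrink U z₀ s) : Metric.closedBall x ε ⊆ U := by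
  intro y hy
  have hz : z₀ + s⁻¹ • (y - x) ∈ Metric.ball z₀ ρ := by
    rw [Metric.mem_closedBall, dist_eq_norm] at hy
    rw [Metric.mem_ball, dist_eq_norm, add_sub_cancel_left, norm_smul, Real.norm_eq_abs,
      abs_of_pos (by positivity), inv_mul_lt_iff₀ hs]
    linarith
  have := hstar _ hz hx hs.le (sub_nonneg.2 hs1.le) (by ring)
  convert this using 1
  have h1 : 1 - s ≠ 0 := by linarith
  rw [smul_add, smul_smul, mul_inv_cancel₀ hs.ne', smul_add, smul_smul, mul_inv_cancel₀ h1]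
  module

lemma shrink_starConvex {U : Set Plane} {z₀ : Plane} {ρ : ℝ}
    (hstar : ∀ z ∈ Metric.ball z₀ ρ, StarConvex ℝ z U) {s : ℝ} (hs1 : s < 1) {z : Plane}
    (hz : z ∈ Metric.ball z₀ ((1 - s) * ρ)) : StarConvex ℝ z (shrink U z₀ s) := by
  intro x hx a b ha hb hab
  have h1 : 0 < 1 - s := by linarith
  have hz' : z₀ + (1 - s)⁻¹ • (z - z₀) ∈ Metric.ball z₀ ρ := by
    rw [Metric.mem_ball, dist_eq_norm] at hz
    rw [Metric.mem_ball, dist_eq_norm, add_sub_cancel_left, norm_smul, Real.norm_eq_abs,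
      abs_of_pos (by positivity), inv_mul_lt_iff₀ h1]
    exact hz
  have := hstar _ hz' hx ha hb hab
  have e : z₀ + (1 - s)⁻¹ • (a • z + b • x - z₀) =
      a • (z₀ + (1 - s)⁻¹ • (z - z₀)) + b • (z₀ + (1 - s)⁻¹ • (x - z₀)) := by
    obtain rfl : b = 1 - a := by linarith
    module
  change z₀ + (1 - s)⁻¹ • (a • z + b • x - z₀) ∈ U
  rw [e]
  exact this

/-- The smooth inequality holds for mollifications of `u` on shrunken copies of `U`, with a bound
independent of the copy. Mollifications converge almost everywhere, so Fatou's lemma in each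
variable gives the limit. -/
lemma lintegral_lintegral_enorm_sub_sq_le_of_isWeakGradient {R U : Set Plane} (hR : IsOpen R)
    (hU : IsOpen U) (hUR : U ⊆ R) {z₀ : Plane} {ρ : ℝ} (hρ : 0 < ρ)
    (hball : Metric.ball z₀ ρ ⊆ U) (hstar : ∀ z ∈ Metric.ball z₀ ρ, StarConvex ℝ z U) {D : ℝ≥0}
    (hD : ∀ x ∈ U, ∀ z ∈ U, ‖x - z‖ ≤ D) {u : L2 R} {g : L2Vec R}
    (hu : IsWeakGradient R u g) :
    ∫⁻ x in U, ∫⁻ z in Metric.ball z₀ (ρ / 2), ‖u x - u z‖ₑ ^ 2 ≤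
      (D : ENNReal) ^ 2 * (4 * volume U * ‖g‖ₑ ^ 2) := by
  set B := Metric.ball z₀ (ρ / 2) with hB
  have hBU : B ⊆ U := (Metric.ball_subset_ball (by linarith)).trans hball
  -- The shift by 2 keeps `s n ≤ 1/2`, so that the fixed ball of radius `ρ / 2` lies in every
  -- shrunken copy of the original ball.
  set s : ℕ → ℝ := fun n => 1 / ((n : ℝ) + 2) with hs
  have hs0 : ∀ n, 0 < s n := fun n => by positivity
  have hs2 : ∀ n, s n ≤ 1 / 2 := fun n => by
    apply one_div_le_one_div_of_le <;> linarith [(Nat.cast_nonneg n : (0 : ℝ) ≤ n)]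
  have hst : Tendsto s atTop (𝓝 0) := by
    have := (tendsto_one_div_add_atTop_nhds_zero_nat (𝕜 := ℝ)).comp (tendsto_add_atTop_nat 1)
    refine this.congr fun n => ?_
    simp only [hs, Function.comp]
    push_cast
    ring
  -- The outer radius is below `s n * ρ`, the room left by shrinking. The fixed ratio 2 of the radii
  -- is what the almost everywhere convergence theorem asks for.
  let η : ℕ → ContDiffBump (0 : Plane) := fun n =>
    ⟨s n * ρ / 4, s n * ρ / 2, by have := hs0 n; positivity,
      by nlinarith [mul_pos (hs0 n) hρ]⟩
  let v : ℕ → Plane → ℝ := fun n => mollify R (η n) u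
  have hvc : ∀ n, ContDiff ℝ 1 (v n) := fun n => contDiff_mollify hR.measurableSet _ _
  have hcl : ∀ n, ∀ x ∈ shrink U z₀ (s n), Metric.closedBall x (η n).rOut ⊆ U := fun n x hx =>
    closedBall_subset_of_mem_shrink hstar (hs0 n) (by linarith [hs2 n])
      (by change s n * ρ / 2 < s n * ρ; nlinarith [mul_pos (hs0 n) hρ]) hx
  have hVU : ∀ n, shrink U z₀ (s n) ⊆ U := fun n x hx =>
    hcl n x hx (Metric.mem_closedBall_self (η n).rOut_pos.le)
  have hB1 : ∀ n, B ⊆ Metric.ball z₀ ((1 - s n) * ρ) := fun n =>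
    Metric.ball_subset_ball (by nlinarith [hs2 n])
  have hBV : ∀ n, B ⊆ shrink U z₀ (s n) := by
    intro n z hz
    have h1 : 0 < 1 - s n := by linarith [hs2 n]
    have hz' := hB1 n hz
    refine hball ?_
    rw [Metric.mem_ball, dist_eq_norm] at hz' ⊢
    rw [add_sub_cancel_left, norm_smul, Real.norm_eq_abs,
      abs_of_pos (by positivity), inv_mul_lt_iff₀ h1]
    exact hz'
  have hbound : ∀ n, ∫⁻ x in shrink U z₀ (s n), ∫⁻ z in B, ‖v n x - v n z‖ₑ ^ 2 ≤
      (D : ENNReal) ^ 2 * (4 * volume U * ‖g‖ₑ ^ 2) := by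
    intro n
    refine (lintegral_lintegral_enorm_sub_sq_le (isOpen_shrink hU z₀ _) Metric.isOpen_ball (hBV n)
      (fun z hz => shrink_starConvex hstar (by linarith [hs2 n]) (hB1 n hz))
      (fun x hx z hz => hD x (hVU n hx) z (hVU n hz)) (hvc n)).trans ?_
    gcongr
    · exact hVU n
    · rw [← lintegral_enorm_coe_sq]
      exact setLIntegral_enorm_fderiv_mollify_sq_le hR (isOpen_shrink hU z₀ _).measurableSet hu
        (η n) fun x hx => (hcl n x hx).trans hUR
  have hae : ∀ᵐ x : Plane, Tendsto (fun n => v n x) atTop (𝓝 (R.indicator u x)) := by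
    refine ContDiffBump.ae_convolution_tendsto_right_of_locallyIntegrable (K := 2) ?_ ?_
      (locallyIntegrable_indicator_coe hR.measurableSet u)
    · change Tendsto (fun n => s n * ρ / 2) atTop (𝓝 0)
      simpa using (hst.mul_const ρ).div_const 2
    · refine .of_forall fun n => ?_
      change s n * ρ / 2 ≤ 2 * (s n * ρ / 4)
      linarith
  have hev : ∀ x ∈ U, ∀ᶠ n in atTop, x ∈ shrink U z₀ (s n) := by
    intro x hx
    have h1 : Tendsto (fun n => z₀ + (1 - s n)⁻¹ • (x - z₀)) atTop (𝓝 x) := by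
      have h2 : Tendsto (fun n => (1 - s n)⁻¹) atTop (𝓝 1) := by
        simpa using (hst.const_sub 1).inv₀ (by norm_num)
      simpa using (h2.smul_const (x - z₀)).const_add z₀
    exact h1.eventually (hU.mem_nhds hx)
  have hmeas : ∀ n, Measurable fun x => ∫⁻ z in B, ‖v n x - v n z‖ₑ ^ 2 := by
    intro n
    have hc := (hvc n).continuous
    exact Measurable.lintegral_prod_right' (f := fun p : Plane × Plane => ‖v n p.1 - v n p.2‖ₑ ^ 2)
      (by fun_prop)
  have hinner : ∀ x : Plane, x ∈ U → Tendsto (fun n => v n x) atTop (𝓝 (R.indicator u x)) →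
      ∫⁻ z in B, ‖u x - u z‖ₑ ^ 2 ≤ liminf (fun n => (shrink U z₀ (s n)).indicator
        (fun x => ∫⁻ z in B, ‖v n x - v n z‖ₑ ^ 2) x) atTop := by
    intro x hxU hx
    calc ∫⁻ z in B, ‖u x - u z‖ₑ ^ 2
        ≤ ∫⁻ z in B, liminf (fun n => ‖v n x - v n z‖ₑ ^ 2) atTop := by
          refine lintegral_mono_ae ?_
          filter_upwards [ae_restrict_of_ae hae, ae_restrict_mem Metric.isOpen_ball.measurableSet]
            with z hz hzB
          rw [indicator_of_mem (hUR hxU)] at hx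
          rw [indicator_of_mem (hUR (hBU hzB))] at hz
          exact (((ENNReal.continuous_pow 2).tendsto _).comp (hx.sub hz).enorm).liminf_eq.ge
      _ ≤ liminf (fun n => ∫⁻ z in B, ‖v n x - v n z‖ₑ ^ 2) atTop := by
          refine lintegral_liminf_le fun n => ?_
          have hc := (hvc n).continuous
          fun_prop
      _ = _ := by
          refine liminf_congr ?_
          filter_upwards [hev x hxU] with n hn
          rw [indicator_of_mem hn]
  calc ∫⁻ x in U, ∫⁻ z in B, ‖u x - u z‖ₑ ^ 2
      ≤ ∫⁻ x in U, liminf (fun n => (shrink U z₀ (s n)).indicator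
        (fun x => ∫⁻ z in B, ‖v n x - v n z‖ₑ ^ 2) x) atTop := by
        refine lintegral_mono_ae ?_
        filter_upwards [ae_restrict_of_ae hae, ae_restrict_mem hU.measurableSet] with x hx hxU
        exact hinner x hxU hx
    _ ≤ liminf (fun n => ∫⁻ x in U, (shrink U z₀ (s n)).indicator
        (fun x => ∫⁻ z in B, ‖v n x - v n z‖ₑ ^ 2) x) atTop :=
        lintegral_liminf_le fun n =>
          (hmeas n).indicator (isOpen_shrink hU z₀ _).measurableSet
    _ ≤ liminf (fun _ : ℕ => (D : ENNReal) ^ 2 * (4 * volume U * ‖g‖ₑ ^ 2)) atTop := by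
        refine liminf_le_liminf (.of_forall fun n => ?_)
        refine (setLIntegral_le_lintegral _ _).trans ?_
        rw [lintegral_indicator (isOpen_shrink hU z₀ _).measurableSet]
        exact hbound n
    _ = _ := by simp

lemma poincareOn_of_starConvex {R U : Set Plane} (hR : IsOpen R) (hRb : Bornology.IsBounded R)
    (hU : IsOpen U) (hUR : U ⊆ R) {z₀ : Plane} {ρ : ℝ} (hρ : 0 < ρ)
    (hball : Metric.ball z₀ ρ ⊆ U) (hstar : ∀ z ∈ Metric.ball z₀ ρ, StarConvex ℝ z U) :
    PoincareOn R U := by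
  have hUb := hRb.subset hUR
  obtain ⟨D, hD⟩ := Metric.isBounded_iff.1 hUb
  have hD' : ∀ x ∈ U, ∀ z ∈ U, ‖x - z‖ ≤ D.toNNReal := fun x hx z hz => by
    rw [← dist_eq_norm]
    exact (hD hx hz).trans (Real.le_coe_toNNReal D)
  set B := Metric.ball z₀ (ρ / 2) with hB
  have hB0 : volume B ≠ 0 := (Metric.measure_ball_pos volume z₀ (by positivity)).ne'
  have hBt : volume B ≠ ⊤ := Metric.isBounded_ball.measure_lt_top.ne
  have hUt : volume U ≠ ⊤ := hUb.measure_lt_top.ne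
  have hBU : B ⊆ U := (Metric.ball_subset_ball (by linarith)).trans hball
  set K : ENNReal := (D.toNNReal : ENNReal) ^ 2 * (4 * volume U) / volume B with hK
  have hKt : K ≠ ⊤ := ENNReal.div_ne_top (by finiteness) hB0
  refine ⟨(K ^ (1 / 2 : ℝ)).toNNReal, fun u g hu => ?_⟩
  have hum : AEMeasurable u (volume.restrict U) :=
    (Lp.aestronglyMeasurable u).aemeasurable.mono_measure (Measure.restrict_mono hUR le_rfl)
  have huB : AEMeasurable u (volume.restrict B) :=
    hum.mono_measure (Measure.restrict_mono hBU le_rfl)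
  have hmeas : AEMeasurable (fun p : Plane × Plane => ‖u p.1 - u p.2‖ₑ ^ 2)
      ((volume.restrict U).prod (volume.restrict B)) :=
    (((hum.comp_quasiMeasurePreserving Measure.quasiMeasurePreserving_fst).sub
      (huB.comp_quasiMeasurePreserving Measure.quasiMeasurePreserving_snd)).enorm).pow_const 2
  have hle := lintegral_lintegral_enorm_sub_sq_le_of_isWeakGradient hR hU hUR hρ hball hstar hD' hu
  rw [lintegral_lintegral_swap hmeas] at hle
  -- Some `z` in the ball does no worse than the average; its value `u z` serves as the constant, so
  -- no mean of `u` has to be computed.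
  obtain ⟨z, -, hz⟩ := exists_le_setLAverage hB0 hBt
    (f := fun z => ∫⁻ x in U, ‖u x - u z‖ₑ ^ 2) (by
      exact hmeas.prod_swap.lintegral_prod_right')
  refine ⟨u z, ?_⟩
  rw [setLAverage_eq] at hz
  have h2 : eLpNorm (fun x => u x - u z) 2 (volume.restrict U) ^ 2 ≤
      (K ^ (1 / 2 : ℝ) * ‖g‖ₑ) ^ 2 := by
    rw [eLpNorm_two_sq, mul_pow, ← ENNReal.rpow_two (K ^ (1 / 2 : ℝ)), ← ENNReal.rpow_mul]
    refine hz.trans ?_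
    refine (ENNReal.div_le_div_right hle _).trans (le_of_eq ?_)
    norm_num
    rw [hK]
    simp only [div_eq_mul_inv]
    ring
  rw [ENNReal.coe_toNNReal (ENNReal.rpow_ne_top_of_nonneg (by norm_num) hKt)]
  exact (ENNReal.pow_le_pow_left_iff two_ne_zero).1 h2

lemma eLpNorm_restrict_union_le {F : Type*} [NormedAddCommGroup F] {α : Type*} [MeasurableSpace α]
    {μ : Measure α} (f : α → F) (U V : Set α) :
    eLpNorm f 2 (μ.restrict (U ∪ V)) ≤
      eLpNorm f 2 (μ.restrict U) + eLpNorm f 2 (μ.restrict V) := by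
  rw [← ENNReal.pow_le_pow_left_iff two_ne_zero, add_sq, eLpNorm_two_sq, eLpNorm_two_sq,
    eLpNorm_two_sq]
  refine (lintegral_union_le _ _ _).trans ?_
  gcongr
  exact le_self_add

/-- On the overlap, which has positive measure, `u` is close to both constants, so these differ by
at most a multiple of the norm of `g`. One of them therefore serves on the whole union. -/
lemma PoincareOn.union {R U V : Set Plane} (hRb : Bornology.IsBounded R) (hU : IsOpen U)
    (hV : IsOpen V) (hUR : U ⊆ R) (hVR : V ⊆ R) (hUV : (U ∩ V).Nonempty) (h₁ : PoincareOn R U)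
    (h₂ : PoincareOn R V) : PoincareOn R (U ∪ V) := by
  obtain ⟨C₁, h₁⟩ := h₁
  obtain ⟨C₂, h₂⟩ := h₂
  have hW : volume (U ∩ V) ≠ 0 := ((hU.inter hV).measure_pos volume hUV).ne'
  have hWt : volume (U ∩ V) ≠ ⊤ :=
    (hRb.subset (inter_subset_left.trans hUR)).measure_lt_top.ne
  have hVt : volume V ≠ ⊤ := (hRb.subset hVR).measure_lt_top.ne
  set m : ENNReal := volume (U ∩ V) ^ (1 / 2 : ℝ) with hm
  set k : ENNReal := volume V ^ (1 / 2 : ℝ) with hk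
  have hm0 : m ≠ 0 := by simp [hm, hW, hWt]
  have hmt : m ≠ ⊤ := ENNReal.rpow_ne_top_of_nonneg (by norm_num) hWt
  have hkt : k ≠ ⊤ := ENNReal.rpow_ne_top_of_nonneg (by norm_num) hVt
  have hconst : ∀ (c : ℝ) (S : Set Plane), volume S ≠ 0 →
      eLpNorm (fun _ => c) 2 (volume.restrict S) = ‖c‖ₑ * volume S ^ (1 / 2 : ℝ) := by
    intro c S hS
    rw [eLpNorm_const _ (by simp) (by simpa using hS)]
    simp
  have hV0 : volume V ≠ 0 := fun h => hW (measure_mono_null inter_subset_right h)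
  set K : ENNReal := C₁ + (C₂ + (C₁ + C₂) / m * k) with hK
  have hKt : K ≠ ⊤ := by
    have : (C₁ + C₂ : ENNReal) / m ≠ ⊤ := ENNReal.div_ne_top (by simp) hm0
    finiteness
  refine ⟨K.toNNReal, fun u g hu => ?_⟩
  obtain ⟨c, hc⟩ := h₁ u g hu
  obtain ⟨d, hd⟩ := h₂ u g hu
  have hum : ∀ S ⊆ R, ∀ c : ℝ,
      AEStronglyMeasurable (fun x => u x - c) (volume.restrict S) := fun S hS c =>
    ((Lp.aestronglyMeasurable u).mono_measure (Measure.restrict_mono hS le_rfl)).sub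
      aestronglyMeasurable_const
  have hcd : ‖d - c‖ₑ ≤ (C₁ + C₂) / m * ‖g‖ₑ := by
    rw [ENNReal.mul_comm_div, ← mul_div_assoc, ENNReal.le_div_iff_mul_le (.inl hm0) (.inl hmt)]
    calc ‖d - c‖ₑ * m = eLpNorm (fun _ => d - c) 2 (volume.restrict (U ∩ V)) :=
          (hconst _ _ hW).symm
      _ = eLpNorm ((fun x => u x - c) - fun x => u x - d) 2 (volume.restrict (U ∩ V)) := by
          congr 1; ext x; simp
      _ ≤ eLpNorm (fun x => u x - c) 2 (volume.restrict (U ∩ V)) +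
          eLpNorm (fun x => u x - d) 2 (volume.restrict (U ∩ V)) :=
        eLpNorm_sub_le (hum _ (inter_subset_left.trans hUR) _)
          (hum _ (inter_subset_left.trans hUR) _) (by norm_num)
      _ ≤ C₁ * ‖g‖ₑ + C₂ * ‖g‖ₑ := add_le_add
        ((eLpNorm_mono_measure _ (Measure.restrict_mono inter_subset_left le_rfl)).trans hc)
        ((eLpNorm_mono_measure _ (Measure.restrict_mono inter_subset_right le_rfl)).trans hd)
      _ = (C₁ + C₂) * ‖g‖ₑ := by ring
  refine ⟨c, (eLpNorm_restrict_union_le _ _ _).trans ?_⟩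
  have hVc : eLpNorm (fun x => u x - c) 2 (volume.restrict V) ≤
      C₂ * ‖g‖ₑ + (C₁ + C₂) / m * ‖g‖ₑ * k := by
    calc eLpNorm (fun x => u x - c) 2 (volume.restrict V)
        = eLpNorm ((fun x => u x - d) + fun _ => d - c) 2 (volume.restrict V) := by
          congr 1; ext x; simp
      _ ≤ _ := eLpNorm_add_le (hum _ hVR _) aestronglyMeasurable_const (by norm_num)
      _ ≤ _ := by rw [hconst _ _ hV0]; gcongr
  rw [ENNReal.coe_toNNReal hKt]
  calc _ ≤ C₁ * ‖g‖ₑ + (C₂ * ‖g‖ₑ + (C₁ + C₂) / m * ‖g‖ₑ * k) := add_le_add hc hVc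
    _ = K * ‖g‖ₑ := by rw [hK]; ring

/-- Take a maximal subfamily whose union satisfies the inequality. If it missed a point of `R`,
connectedness would give a remaining piece meeting the union, and gluing it on would contradict
maximality. -/
lemma poincareOn_of_cover {ι : Type*} [DecidableEq ι] {R : Set Plane}
    (hRb : Bornology.IsBounded R) (hRc : IsConnected R) (t : Finset ι) (U : ι → Set Plane)
    (hU : ∀ i ∈ t, IsOpen (U i) ∧ U i ⊆ R ∧ (U i).Nonempty ∧ PoincareOn R (U i))
    (ht : R ⊆ ⋃ i ∈ t, U i) : PoincareOn R R := by
  let good : Finset (Finset ι) :=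
    by classical exact t.powerset.filter fun s => s.Nonempty ∧ PoincareOn R (⋃ i ∈ s, U i)
  have hgood : ∀ s, s ∈ good ↔ s ⊆ t ∧ s.Nonempty ∧ PoincareOn R (⋃ i ∈ s, U i) := by
    intro s; simp [good]
  have hne : good.Nonempty := by
    obtain ⟨x, hx⟩ := hRc.nonempty
    obtain ⟨i, hi, -⟩ := mem_iUnion₂.1 (ht hx)
    exact ⟨{i}, (hgood _).2 ⟨by simpa using hi, by simp, by simpa using (hU i hi).2.2.2⟩⟩
  obtain ⟨s, hs⟩ := good.exists_maximal hne
  obtain ⟨hst, ⟨i₀, hi₀⟩, hsP⟩ := (hgood s).1 hs.prop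
  have hAR : (⋃ i ∈ s, U i) ⊆ R := iUnion₂_subset fun i hi => (hU i (hst hi)).2.1
  have hAo : IsOpen (⋃ i ∈ s, U i) := isOpen_biUnion fun i hi => (hU i (hst hi)).1
  suffices h : R ⊆ ⋃ i ∈ s, U i by rwa [hAR.antisymm h] at hsP
  by_contra hcon
  obtain ⟨x, hxR, hxA⟩ := not_subset.1 hcon
  have hB : R ⊆ (⋃ i ∈ s, U i) ∪ ⋃ i ∈ t \ s, U i := by
    intro y hy
    obtain ⟨i, hi, hyi⟩ := mem_iUnion₂.1 (ht hy)
    by_cases his : i ∈ s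
    · exact .inl (mem_iUnion₂.2 ⟨i, his, hyi⟩)
    · exact .inr (mem_iUnion₂.2 ⟨i, by simp [hi, his], hyi⟩)
  obtain ⟨y₀, hy₀⟩ := (hU i₀ (hst hi₀)).2.2.1
  obtain ⟨y, -, hyA, hyB⟩ := hRc.isPreconnected _ _ hAo
    (isOpen_biUnion fun i hi => (hU i (Finset.mem_sdiff.1 hi).1).1) hB
    ⟨y₀, (hU i₀ (hst hi₀)).2.1 hy₀, mem_iUnion₂.2 ⟨i₀, hi₀, hy₀⟩⟩
    ⟨x, hxR, (hB hxR).resolve_left hxA⟩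
  obtain ⟨j, hj, hyj⟩ := mem_iUnion₂.1 hyB
  obtain ⟨hjt, hjs⟩ := Finset.mem_sdiff.1 hj
  have hins : insert j s ∈ good := by
    refine (hgood _).2 ⟨Finset.insert_subset hjt hst, Finset.insert_nonempty _ _, ?_⟩
    rw [Finset.set_biUnion_insert]
    exact PoincareOn.union hRb (hU j hjt).1 hAo (hU j hjt).2.1 hAR ⟨y, hyj, hyA⟩
      (hU j hjt).2.2.2 hsP
  exact hjs (hs.le_of_ge hins (Finset.subset_insert j s) (Finset.mem_insert_self j s))

/-! ### Local geometry of Lipschitz domains. -/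

/-- A boundary point above the graph would lie in the open set `R`; one below it would have a
neighbourhood disjoint from `R`. -/
lemma IsBoundedLipschitzDomain.apply_one_eq {R : Set Plane} (hR : IsOpen R) {p : Plane}
    (hp : p ∈ frontier R) {δ : ℝ} {e : Plane ≃ᵃⁱ[ℝ] Plane} {γ : ℝ → ℝ} (hγ : Continuous γ)
    (hgr : ∀ x ∈ Metric.ball p δ, x ∈ R ↔ γ (e x 0) < e x 1) (hpδ : p ∈ Metric.ball p δ) :
    e p 1 = γ (e p 0) := by
  rw [hR.frontier_eq] at hp
  refine le_antisymm (not_lt.1 fun h => hp.2 ((hgr p hpδ).2 h)) (not_lt.1 fun h => ?_)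
  have hec : Continuous e := e.continuous
  have hopen : IsOpen (Metric.ball p δ ∩ {x | e x 1 < γ (e x 0)}) :=
    Metric.isOpen_ball.inter (isOpen_lt (by fun_prop) (by fun_prop))
  obtain ⟨x, ⟨hxδ, hx⟩, hxR⟩ := mem_closure_iff.1 hp.1 _ hopen ⟨hpδ, h⟩
  exact lt_asymm hx ((hgr x hxδ).1 hxR)

/-- The part of an epigraph between the graph and the height `b`, over an interval. -/
def epigraphStrip (γ : ℝ → ℝ) (a h b : ℝ) : Set Plane :=
  {y | |y 0 - a| < h ∧ γ (y 0) < y 1 ∧ y 1 < b}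

/-- In the threshold `3 * K * h`, one `K * h` bounds the rise of `γ` above `γ a` over the interval
and `2 * K * h` allows for the full width `2 * h` at slope `K`. -/
lemma starConvex_epigraphStrip {γ : ℝ → ℝ} {K : ℝ≥0} (hγ : LipschitzWith K γ) {a h b : ℝ}
    {z : Plane} (hz0 : |z 0 - a| < h) (hz1 : γ a + 3 * K * h < z 1) (hz2 : z 1 < b) :
    StarConvex ℝ z (epigraphStrip γ a h b) := by
  have hlip : ∀ s t, γ s ≤ γ t + K * |s - t| := fun s t => by
    have := (abs_le.1 (hγ.dist_le_mul s t)).2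
    rw [Real.dist_eq] at this
    linarith
  rintro y ⟨hy0, hy1, hy2⟩ s t hs ht hst
  obtain rfl : s = 1 - t := by linarith
  have hK : (0 : ℝ) ≤ K := K.2
  have e0 : ((1 - t) • z + t • y : Plane) 0 = (1 - t) * z 0 + t * y 0 := by simp
  have e1 : ((1 - t) • z + t • y : Plane) 1 = (1 - t) * z 1 + t * y 1 := by simp
  have hw : |(1 - t) * z 0 + t * y 0 - a| < h := by
    rw [abs_lt] at *
    rcases hs.eq_or_lt with h0 | h0
    · obtain rfl : t = 1 := by linarith
      constructor <;> linarith
    · constructor <;> nlinarith [mul_lt_mul_of_pos_left hz0.1 h0, mul_lt_mul_of_pos_left hz0.2 h0,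
        mul_le_mul_of_nonneg_left hy0.1.le ht, mul_le_mul_of_nonneg_left hy0.2.le ht]
  have hd : |z 0 - y 0| ≤ 2 * h := by
    rw [abs_lt] at hz0 hy0
    rw [abs_le]
    constructor <;> linarith
  refine ⟨by rwa [e0], ?_, ?_⟩
  · rw [e0, e1]
    -- If `y` lies in the downward cone of slope `K` at `z`, the segment from `y` to `z` rises at
    -- least as fast as `γ` can. Otherwise both endpoints lie above `γ a + K * h`, which bounds `γ`
    -- over the whole interval.
    rcases le_or_gt (y 1) (z 1 - K * |z 0 - y 0|) with hc | hc
    · have h1 := hlip ((1 - t) * z 0 + t * y 0) (y 0)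
      have h2 : |(1 - t) * z 0 + t * y 0 - y 0| = (1 - t) * |z 0 - y 0| := by
        rw [← abs_of_nonneg hs, ← abs_mul, abs_of_nonneg hs]
        congr 1
        ring
      rw [h2] at h1
      have h3 := mul_le_mul_of_nonneg_left hc hs
      linarith
    · have h1 := hlip ((1 - t) * z 0 + t * y 0) a
      have h2 : K * |(1 - t) * z 0 + t * y 0 - a| ≤ K * h := by gcongr
      have h3 : K * |z 0 - y 0| ≤ K * (2 * h) := by gcongr
      have hh : 0 ≤ h := (abs_nonneg _).trans hz0.le
      have hKh : 0 ≤ K * h := by positivity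
      have h4 : γ a + K * h < z 1 := by linarith
      have h5 : γ a + K * h < y 1 := by linarith
      rcases hs.eq_or_lt with h0 | h0
      · obtain rfl : t = 1 := by linarith
        linarith
      · have := mul_lt_mul_of_pos_left h4 h0
        have := mul_le_mul_of_nonneg_left h5.le ht
        linarith
  · rw [e1]
    rcases hs.eq_or_lt with h0 | h0
    · obtain rfl : t = 1 := by linarith
      linarith
    · have := mul_lt_mul_of_pos_left hz2 h0
      have := mul_le_mul_of_nonneg_left hy2.le ht
      linarith

lemma starConvex_preimage_affineIsometryEquiv {S : Set Plane} {e : Plane ≃ᵃⁱ[ℝ] Plane} {z : Plane}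
    (h : StarConvex ℝ (e z) S) : StarConvex ℝ z (e ⁻¹' S) := by
  intro x hx s t hs ht hst
  have := h hx hs ht hst
  rw [mem_preimage]
  convert this using 1
  have := Convex.combo_affine_apply (f := e.toAffineEquiv.toAffineMap) (x := z) (y := x) hst
  exact this

lemma dist_le_abs_add_abs (x y : Plane) : dist x y ≤ |x 0 - y 0| + |x 1 - y 1| := by
  rw [EuclideanSpace.dist_eq, Fin.sum_univ_two, Real.dist_eq, Real.dist_eq]
  refine Real.sqrt_le_iff.2 ⟨by positivity, ?_⟩
  nlinarith [abs_nonneg (x 0 - y 0), abs_nonneg (x 1 - y 1)]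

lemma abs_sub_le_dist (x y : Plane) (i : Fin 2) : |x i - y i| ≤ dist x y := by
  rw [dist_eq_norm]
  exact PiLp.norm_apply_le (x - y) i

lemma IsBoundedLipschitzDomain.exists_nhds {R : Set Plane} (hR : IsBoundedLipschitzDomain R)
    {p : Plane} (hp : p ∈ closure R) : ∃ U : Set Plane, IsOpen U ∧ U ⊆ R ∧ U.Nonempty ∧
      PoincareOn R U ∧ ∃ N ∈ 𝓝 p, N ∩ R ⊆ U := by
  by_cases hpR : p ∈ R
  · obtain ⟨ρ, hρ, hball⟩ := Metric.isOpen_iff.1 hR.isOpen p hpR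
    exact ⟨Metric.ball p ρ, Metric.isOpen_ball, hball, ⟨p, Metric.mem_ball_self hρ⟩,
      poincareOn_of_starConvex hR.isOpen hR.isBounded Metric.isOpen_ball hball hρ subset_rfl
        fun z hz => (convex_ball p ρ).starConvex hz,
      Metric.ball p ρ, Metric.ball_mem_nhds p hρ, inter_subset_left⟩
  have hpf : p ∈ frontier R := by rw [hR.isOpen.frontier_eq]; exact ⟨hp, hpR⟩
  obtain ⟨δ, e, K, γ, hδ, hγ, hgr⟩ := hR.exists_graph p hpf
  have hp1 := IsBoundedLipschitzDomain.apply_one_eq hR.isOpen hpf hγ.continuous hgr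
    (Metric.mem_ball_self hδ)
  have hK : (0 : ℝ) ≤ K := K.2
  set a := e p 0 with ha
  -- Small enough that the strip of half-width `h` and top `b` pulls back into the ball where `R` is
  -- given by the graph.
  obtain ⟨h, hh, hhδ⟩ : ∃ h : ℝ, 0 < h ∧ (4 * K + 3) * h < δ := by
    refine ⟨δ / (4 * K + 4), by positivity, ?_⟩
    rw [mul_div_assoc', div_lt_iff₀ (by positivity)]
    nlinarith
  -- A ball of radius `h` centred at height `γ a + (3 * K + 1) * h` just fits between the
  -- star-shapedness threshold and `b`.
  set b := γ a + (3 * K + 2) * h with hb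
  set S := epigraphStrip γ a h b with hS
  have hec : Continuous e := e.continuous
  have hγc := hγ.continuous
  have hSo : IsOpen S := by
    have h0 : IsOpen {y : Plane | |y 0 - a| < h} := isOpen_lt (by fun_prop) continuous_const
    have h1 : IsOpen {y : Plane | γ (y 0) < y 1} := isOpen_lt (by fun_prop) (by fun_prop)
    have h2 : IsOpen {y : Plane | y 1 < b} := isOpen_lt (by fun_prop) continuous_const
    exact h0.inter (h1.inter h2)
  have hlip : ∀ s, |γ s - γ a| ≤ K * |s - a| := fun s => hγ.dist_le_mul s a
  have hSball : ∀ x, e x ∈ S → x ∈ Metric.ball p δ := by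
    rintro x ⟨h0, h1, h2⟩
    rw [Metric.mem_ball, ← e.isometry.dist_eq]
    refine (dist_le_abs_add_abs _ _).trans_lt ?_
    have h3 := (abs_le.1 (hlip (e x 0))).1
    have h4 : K * |e x 0 - a| ≤ K * h := by gcongr
    have hKh : 0 ≤ K * h := by positivity
    have h5 : |e x 1 - e p 1| ≤ (3 * K + 2) * h := by
      rw [hp1, abs_le]
      constructor <;> nlinarith
    calc |e x 0 - e p 0| + |e x 1 - e p 1| < h + (3 * K + 2) * h := add_lt_add_of_lt_of_le h0 h5
      _ ≤ (4 * K + 3) * h := by nlinarith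
      _ < δ := hhδ
  have hSR : e ⁻¹' S ⊆ R := fun x hx => (hgr x (hSball x hx)).2 hx.2.1
  set q : Plane := !₂[a, γ a + (3 * K + 1) * h] with hq
  have hq0 : q 0 = a := by simp [hq]
  have hq1 : q 1 = γ a + (3 * K + 1) * h := by simp [hq]
  have hqb : ∀ z, e z ∈ Metric.ball q h →
      |e z 0 - a| < h ∧ γ a + 3 * K * h < e z 1 ∧ e z 1 < b := by
    intro z hz
    have h0 := (abs_sub_le_dist (e z) q 0).trans_lt hz
    have h1 := abs_lt.1 ((abs_sub_le_dist (e z) q 1).trans_lt hz)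
    rw [hq0] at h0
    rw [hq1] at h1
    exact ⟨h0, by linarith, by linarith⟩
  have hez : ∀ z ∈ Metric.ball (e.symm q) h, e z ∈ Metric.ball q h := by
    intro z hz
    rwa [Metric.mem_ball, ← e.isometry.dist_eq, e.apply_symm_apply] at hz
  have hballS : Metric.ball (e.symm q) h ⊆ e ⁻¹' S := by
    intro z hz
    obtain ⟨h0, h1, h2⟩ := hqb z (hez z hz)
    refine ⟨h0, ?_, h2⟩
    have h3 := (abs_le.1 (hlip (e z 0))).2
    have h4 : K * |e z 0 - a| ≤ K * h := by gcongr
    have hKh : 0 ≤ K * h := by positivity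
    linarith
  refine ⟨e ⁻¹' S, hSo.preimage hec, hSR,
    ⟨e.symm q, hballS (Metric.mem_ball_self hh)⟩,
    poincareOn_of_starConvex hR.isOpen hR.isBounded (hSo.preimage hec) hSR hh hballS
      fun z hz => ?_,
    {x | |e x 0 - a| < h ∧ e x 1 < b} ∩ Metric.ball p δ, ?_, ?_⟩
  · obtain ⟨h0, h1, h2⟩ := hqb z (hez z hz)
    exact starConvex_preimage_affineIsometryEquiv (starConvex_epigraphStrip hγ h0 h1 h2)
  · have h0 : IsOpen {x : Plane | |e x 0 - a| < h} := isOpen_lt (by fun_prop) continuous_const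
    have h1 : IsOpen {x : Plane | e x 1 < b} := isOpen_lt (by fun_prop) continuous_const
    refine ((h0.inter h1).inter Metric.isOpen_ball).mem_nhds
      ⟨⟨by simpa [ha] using hh, ?_⟩, Metric.mem_ball_self hδ⟩
    change e p 1 < b
    rw [hp1]
    have : 0 < (3 * K + 2) * h := by positivity
    linarith
  · rintro x ⟨⟨⟨h0, h1⟩, h2⟩, hxR⟩
    exact ⟨h0, (hgr x h2).1 hxR, h1⟩

/-- The Poincaré inequality on a bounded Lipschitz domain. -/
theorem IsBoundedLipschitzDomain.poincareOn {R : Set Plane} (hR : IsBoundedLipschitzDomain R) :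
    PoincareOn R R := by
  classical
  choose! U hUo hUR hUn hUP N hN hNU using fun p (hp : p ∈ closure R) => hR.exists_nhds hp
  obtain ⟨t, ht, hcov⟩ := hR.isBounded.isCompact_closure.elim_nhds_subcover N hN
  refine poincareOn_of_cover hR.isBounded hR.isConnected t U
    (fun i hi => ⟨hUo i (ht i hi), hUR i (ht i hi), hUn i (ht i hi), hUP i (ht i hi)⟩)
    fun x hx => ?_
  obtain ⟨i, hi, hxi⟩ := mem_iUnion₂.1 (hcov (subset_closure hx))
  exact mem_iUnion₂.2 ⟨i, hi, hNU i (ht i hi) ⟨hxi, hx⟩⟩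

/-! ### The boundary is a null set. -/

lemma volume_graph {γ : ℝ → ℝ} (hγ : Continuous γ) : volume {y : Plane | y 1 = γ (y 0)} = 0 := by
  have h1 : volume {q : ℝ × ℝ | q.2 = γ q.1} = 0 := by
    rw [Measure.volume_eq_prod,
      Measure.measure_prod_null (isClosed_eq (by fun_prop) (by fun_prop)).measurableSet]
    refine .of_forall fun s => ?_
    have : Prod.mk s ⁻¹' {q : ℝ × ℝ | q.2 = γ q.1} = {γ s} := by ext; simp
    simp [this]
  have h2 := (volume_preserving_finTwoArrow ℝ).comp
    (EuclideanSpace.volume_preserving_symm_measurableEquiv_toLp (Fin 2))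
  rw [← h2.measure_preimage
    (isClosed_eq (by fun_prop) (by fun_prop)).measurableSet.nullMeasurableSet] at h1
  exact h1

lemma measurePreserving_affineIsometryEquiv (e : Plane ≃ᵃⁱ[ℝ] Plane) :
    MeasurePreserving e := by
  have h := (measurePreserving_add_right (volume : Measure Plane) (e 0)).comp
    e.linearIsometryEquiv.measurePreserving
  have he : ⇑e = (fun x => x + e 0) ∘ e.linearIsometryEquiv := by
    funext x
    simpa using e.map_vadd 0 x
  rwa [he]

/-- Locally the boundary lies on an isometric copy of a graph, null by Fubini. This is needed
because modules may touch the boundary while integrals run over the open set `R`. -/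
lemma IsBoundedLipschitzDomain.volume_frontier {R : Set Plane} (hR : IsBoundedLipschitzDomain R) :
    volume (frontier R) = 0 := by
  refine measure_null_of_locally_null _ fun p hp => ?_
  obtain ⟨δ, e, K, γ, hδ, hγ, hgr⟩ := hR.exists_graph p hp
  refine ⟨Metric.ball p δ ∩ frontier R,
    inter_mem (mem_nhdsWithin_of_mem_nhds (Metric.ball_mem_nhds p hδ)) self_mem_nhdsWithin, ?_⟩
  have hnull : volume (e ⁻¹' {y : Plane | y 1 = γ (y 0)}) = 0 := by
    have hγc := hγ.continuous
    rw [(measurePreserving_affineIsometryEquiv e).measure_preimage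
      (isClosed_eq (by fun_prop) (by fun_prop)).measurableSet.nullMeasurableSet]
    exact volume_graph hγc
  refine measure_mono_null ?_ hnull
  rintro x ⟨hxδ, hxf⟩
  obtain ⟨ε, hε, hεδ⟩ := Metric.isOpen_iff.1 Metric.isOpen_ball x hxδ
  exact IsBoundedLipschitzDomain.apply_one_eq hR.isOpen hxf hγ.continuous
    (fun y hy => hgr y (hεδ hy)) (Metric.mem_ball_self hε)

/-! ### Weak gradients, constants and functions of mean zero. -/

lemma continuous_gradient {φ : Plane → ℝ} (hφ : ContDiff ℝ ∞ φ) : Continuous (gradient φ) :=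
  (InnerProductSpace.toDual ℝ Plane).symm.continuous.comp (hφ.continuous_fderiv (by simp))

lemma hasCompactSupport_gradient {φ : Plane → ℝ} (hφ : HasCompactSupport φ) :
    HasCompactSupport (gradient φ) :=
  (hφ.fderiv ℝ).comp_left (g := (InnerProductSpace.toDual ℝ Plane).symm) (map_zero _)

lemma inner_gradient (φ : Plane → ℝ) (x w : Plane) :
    inner ℝ w (gradient φ x) = fderiv ℝ φ x w := by
  rw [real_inner_comm, gradient, InnerProductSpace.toDual_symm_apply]

lemma inner_eq_integral_mul {R : Set Plane} (f v : L2 R) : inner ℝ f v = ∫ x in R, f x * v x := by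
  rw [L2.inner_def]
  refine integral_congr_ae (.of_forall fun x => ?_)
  simp [mul_comm]

/-- Integration by parts: the classical gradient of a smooth function is a weak gradient. -/
lemma isWeakGradient_toLp {R : Set Plane} {φ : Plane → ℝ} (hφ : ContDiff ℝ ∞ φ)
    (h₁ : MemLp φ 2 (volume.restrict R)) (h₂ : MemLp (gradient φ) 2 (volume.restrict R)) :
    IsWeakGradient R (h₁.toLp φ) (h₂.toLp (gradient φ)) := by
  intro ψ hψ hc hs
  have e1 : ∫ x in R, h₁.toLp φ x • gradient ψ x = ∫ x, φ x • gradient ψ x := by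
    rw [← setIntegral_eq_integral_of_forall_compl_eq_zero (s := R)
      (f := fun x => φ x • gradient ψ x)]
    · refine integral_congr_ae ?_
      filter_upwards [h₁.coeFn_toLp] with x hx
      rw [hx]
    · intro x hx
      have : fderiv ℝ ψ x = 0 := fderiv_of_notMem_tsupport ℝ (fun h => hx (hs h))
      rw [gradient, this, map_zero, smul_zero]
  have e2 : ∫ x in R, ψ x • h₂.toLp (gradient φ) x = ∫ x, ψ x • gradient φ x := by
    rw [← setIntegral_eq_integral_of_forall_compl_eq_zero (s := R)
      (f := fun x => ψ x • gradient φ x)]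
    · refine integral_congr_ae ?_
      filter_upwards [h₂.coeFn_toLp] with x hx
      rw [hx]
    · intro x hx
      rw [image_eq_zero_of_notMem_tsupport (fun h => hx (hs h)), zero_smul]
  have i1 : Integrable (fun x => φ x • gradient ψ x) :=
    (hφ.continuous.smul (continuous_gradient hψ)).integrable_of_hasCompactSupport
      (hasCompactSupport_gradient hc).smul_left
  have i2 : Integrable (fun x => ψ x • gradient φ x) :=
    (hψ.continuous.smul (continuous_gradient hφ)).integrable_of_hasCompactSupport hc.smul_right
  rw [e1, e2]
  refine ext_inner_left ℝ fun w => ?_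
  rw [inner_neg_right, ← integral_inner i1, ← integral_inner i2]
  simp_rw [real_inner_smul_right, inner_gradient]
  have j1 : Integrable (fun x => φ x • fderiv ℝ ψ x w) := by
    simpa only [real_inner_smul_right, inner_gradient, smul_eq_mul] using i1.const_inner (𝕜 := ℝ) w
  have j2 : Integrable (fun x => fderiv ℝ φ x w • ψ x) := by
    simpa only [real_inner_smul_right, inner_gradient, smul_eq_mul, mul_comm]
      using i2.const_inner (𝕜 := ℝ) w
  have j3 : Integrable (fun x => φ x • ψ x) :=
    (hφ.continuous.smul hψ.continuous).integrable_of_hasCompactSupport hc.smul_left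
  have := integral_smul_fderiv_eq_neg_fderiv_smul_of_integrable j2 j1 j3
    (fun x _ => hφ.differentiable (by simp) x) (fun x _ => hψ.differentiable (by simp) x)
  simp only [smul_eq_mul] at this
  rw [this]
  simp_rw [mul_comm]

/-- The fundamental lemma of the calculus of variations; it carries both the uniqueness of weak
gradients and the density of `H¹(R)`. -/
lemma ae_eq_zero_of_forall_integral_smul {F : Type*} [NormedAddCommGroup F] [NormedSpace ℝ F]
    [CompleteSpace F] {R : Set Plane} (hR : IsOpen R) (f : Lp F 2 (volume.restrict R))
    (h : ∀ ψ : Plane → ℝ, ContDiff ℝ ∞ ψ → HasCompactSupport ψ → tsupport ψ ⊆ R →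
      ∫ x in R, ψ x • f x = 0) : f = 0 := by
  have hloc : LocallyIntegrableOn f R (volume.restrict R) :=
    ((Lp.memLp f).locallyIntegrable (by norm_num)).locallyIntegrableOn R
  have := hR.ae_eq_zero_of_integral_contDiff_smul_eq_zero hloc h
  rw [Lp.eq_zero_iff_ae_eq_zero]
  filter_upwards [this, ae_restrict_mem hR.measurableSet] with x hx hxR
  exact hx hxR

lemma IsWeakGradient.eq_zero {R : Set Plane} (hR : IsOpen R) {g : L2Vec R}
    (h : IsWeakGradient R 0 g) : g = 0 := by
  refine ae_eq_zero_of_forall_integral_smul hR g fun ψ hψ hc hs => ?_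
  have h1 := h ψ hψ hc hs
  have h2 : (fun x => (0 : L2 R) x • gradient ψ x) =ᵐ[volume.restrict R] fun _ => 0 := by
    filter_upwards [Lp.coeFn_zero ℝ 2 (volume.restrict R)] with x hx
    rw [hx]; simp
  rw [integral_congr_ae h2, integral_zero] at h1
  exact neg_eq_zero.1 h1.symm

lemma IsWeakGradient.sub {R : Set Plane} {u v : L2 R} {g h : L2Vec R}
    (hu : IsWeakGradient R u g) (hv : IsWeakGradient R v h) :
    IsWeakGradient R (u - v) (g - h) := by
  have := hu.add (hv.smul (-1))
  simpa [sub_eq_add_neg] using this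

/-- The space `H¹(R)` is dense in `L²(R)`. -/
lemma eq_zero_of_forall_inner_isWeakGradient {R : Set Plane} (hR : IsOpen R) {f : L2 R}
    (hf : ∀ (v : L2 R) (h : L2Vec R), IsWeakGradient R v h → inner ℝ f v = 0) : f = 0 := by
  refine ae_eq_zero_of_forall_integral_smul hR f fun ψ hψ hc hs => ?_
  have h1 := hψ.continuous.memLp_of_hasCompactSupport (p := 2) (μ := volume.restrict R) hc
  have h2 := (continuous_gradient hψ).memLp_of_hasCompactSupport (p := 2)
    (μ := volume.restrict R) (hasCompactSupport_gradient hc)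
  have := hf _ _ (isWeakGradient_toLp hψ h1 h2)
  rw [inner_eq_integral_mul] at this
  rw [← this]
  refine integral_congr_ae ?_
  filter_upwards [h1.coeFn_toLp] with x hx
  rw [hx, smul_eq_mul, mul_comm]

lemma isFiniteMeasure_restrict {R : Set Plane} (hRb : Bornology.IsBounded R) :
    IsFiniteMeasure (volume.restrict R) :=
  ⟨by simpa using hRb.measure_lt_top⟩

/-- The constant function `c` as an element of `L²(R)`. -/
noncomputable def constL2 (R : Set Plane) [IsFiniteMeasure (volume.restrict R)] (c : ℝ) : L2 R :=
  (memLp_const c).toLp fun _ => c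

section FiniteMeasure

variable {R : Set Plane} [IsFiniteMeasure (volume.restrict R)]

lemma coeFn_constL2 (c : ℝ) : constL2 R c =ᵐ[volume.restrict R] fun _ => c :=
  MemLp.coeFn_toLp _

lemma isWeakGradient_constL2 (c : ℝ) : IsWeakGradient R (constL2 R c) 0 := by
  have hg : gradient (fun _ : Plane => c) = 0 := by
    ext1 x
    simp [gradient]
  have h2 : MemLp (gradient (fun _ : Plane => c)) 2 (volume.restrict R) := by
    rw [hg]; exact MemLp.zero
  have := isWeakGradient_toLp (R := R) contDiff_const (memLp_const c) h2
  have h0 : h2.toLp _ = 0 := by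
    rw [Lp.eq_zero_iff_ae_eq_zero]
    exact h2.coeFn_toLp.trans (.of_forall fun x => by rw [hg])
  rwa [h0] at this

lemma inner_constL2 (f : L2 R) (c : ℝ) : inner ℝ f (constL2 R c) = c * ∫ x in R, f x := by
  rw [inner_eq_integral_mul, ← integral_const_mul]
  refine integral_congr_ae ?_
  filter_upwards [coeFn_constL2 (R := R) c] with x hx
  rw [hx, mul_comm]

lemma mem_L20_iff {f : L2 R} : f ∈ L20 R ↔ inner ℝ f (constL2 R 1) = 0 := by
  rw [inner_constL2, one_mul]
  exact ⟨fun h => h.2, fun h => ⟨(Lp.memLp f).integrable (by norm_num), h⟩⟩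

lemma inner_constL2_of_mem_L20 {f : L2 R} (hf : f ∈ L20 R) (c : ℝ) :
    inner ℝ f (constL2 R c) = 0 := by
  rw [inner_constL2, hf.2, mul_zero]

lemma exists_sub_constL2_mem_L20 (hR : volume R ≠ 0) (v : L2 R) :
    ∃ c, v - constL2 R c ∈ L20 R := by
  have hv : (volume.restrict R).real univ ≠ 0 := by
    rw [measureReal_ne_zero_iff]
    simpa using hR
  refine ⟨(∫ x in R, v x) / (volume.restrict R).real univ, ?_⟩
  rw [mem_L20_iff, inner_sub_left, inner_constL2, inner_constL2, integral_congr_ae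
    (coeFn_constL2 _), integral_const, smul_eq_mul, mul_div_cancel₀ _ hv]
  ring

/-- A function of mean zero is orthogonal to the constants, so subtracting a constant can only
increase its norm; the unknown constant in `PoincareOn` may be dropped. -/
lemma norm_le_of_poincareOn (h : PoincareOn R R) : ∃ C : ℝ, 0 ≤ C ∧
    ∀ u ∈ L20 R, ∀ g : L2Vec R, IsWeakGradient R u g → ‖u‖ ≤ C * ‖g‖ := by
  obtain ⟨C, hC⟩ := h
  refine ⟨C, C.2, fun u hu g hg => ?_⟩
  obtain ⟨c, hc⟩ := hC u g hg
  have h1 : ‖u - constL2 R c‖ ≤ C * ‖g‖ := by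
    have h2 : ‖u - constL2 R c‖ₑ ≤ C * ‖g‖ₑ := by
      rw [Lp.enorm_def]
      refine (eLpNorm_congr_ae ?_).trans_le hc
      filter_upwards [Lp.coeFn_sub u (constL2 R c), coeFn_constL2 (R := R) c] with x hx hx'
      rw [hx, Pi.sub_apply, hx']
    have h3 := ENNReal.toReal_mono (by finiteness) h2
    simpa using h3
  refine le_trans ?_ h1
  have h4 : ‖u‖ ^ 2 ≤ ‖u - constL2 R c‖ ^ 2 := by
    rw [norm_sub_sq_real, inner_constL2_of_mem_L20 hu]
    nlinarith [sq_nonneg ‖constL2 R c‖]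
  exact (sq_le_sq₀ (norm_nonneg _) (norm_nonneg _)).1 h4

lemma isClosed_L20 : IsClosed (L20 R : Set (L2 R)) := by
  have : (L20 R : Set (L2 R)) = {f | inner ℝ f (constL2 R 1) = 0} := by
    ext f; exact mem_L20_iff
  rw [this]
  exact isClosed_eq (by fun_prop) continuous_const

end FiniteMeasure

/-- For a fixed test function and a fixed direction `w`, both sides of the defining identity are
inner products with fixed `L²` elements, hence continuous. -/
lemma isClosed_setOf_isWeakGradient (R : Set Plane) :
    IsClosed {p : L2 R × L2Vec R | IsWeakGradient R p.1 p.2} := by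
  have hset : {p : L2 R × L2Vec R | IsWeakGradient R p.1 p.2} =
      ⋂ (ψ : Plane → ℝ) (_ : ContDiff ℝ ∞ ψ) (_ : HasCompactSupport ψ) (_ : tsupport ψ ⊆ R)
        (w : Plane), {p | inner ℝ w (∫ x in R, p.1 x • gradient ψ x) =
          -inner ℝ w (∫ x in R, ψ x • p.2 x)} := by
    ext p
    simp only [mem_ofPred_eq, mem_iInter]
    refine ⟨fun h ψ hψ hc hs w => by rw [h ψ hψ hc hs, inner_neg_right],
      fun h ψ hψ hc hs => ext_inner_left ℝ fun w => by rw [h ψ hψ hc hs w, inner_neg_right]⟩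
  rw [hset]
  refine isClosed_iInter fun ψ => isClosed_iInter fun hψ => isClosed_iInter fun hc =>
    isClosed_iInter fun _ => isClosed_iInter fun w => ?_
  have h1 : MemLp (fun x => inner ℝ w (gradient ψ x)) 2 (volume.restrict R) :=
    ((continuous_gradient hψ).memLp_of_hasCompactSupport
      (hasCompactSupport_gradient hc)).const_inner w
  have h2 : MemLp (fun x => ψ x • w) 2 (volume.restrict R) :=
    (hψ.continuous.smul continuous_const).memLp_of_hasCompactSupport hc.smul_right
  have e1 : ∀ u : L2 R, inner ℝ w (∫ x in R, u x • gradient ψ x) = inner ℝ (h1.toLp _) u := by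
    intro u
    rw [← integral_inner (integrable_smul_gradient u hψ hc), inner_eq_integral_mul]
    refine integral_congr_ae ?_
    filter_upwards [h1.coeFn_toLp] with x hx
    rw [hx, real_inner_smul_right, mul_comm]
  have e2 : ∀ g : L2Vec R, inner ℝ w (∫ x in R, ψ x • g x) = inner ℝ (h2.toLp _) g := by
    intro g
    rw [← integral_inner (integrable_smul_field g hψ hc), L2.inner_def]
    refine integral_congr_ae ?_
    filter_upwards [h2.coeFn_toLp] with x hx
    rw [hx, real_inner_smul_right, real_inner_smul_left]
  simp_rw [e1, e2]
  exact isClosed_eq (by fun_prop) (by fun_prop)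

/-! ### Solving the Neumann problem. -/

/-- The functions in `H¹(R)` of integral zero together with their weak gradients. -/
def meanZeroH1 (R : Set Plane) : Submodule ℝ (WithLp 2 (L2 R × L2Vec R)) where
  carrier := {p | p.fst ∈ L20 R ∧ IsWeakGradient R p.fst p.snd}
  zero_mem' := ⟨(L20 R).zero_mem, IsWeakGradient.zero R⟩
  add_mem' := fun hp hq => ⟨(L20 R).add_mem hp.1 hq.1, hp.2.add hq.2⟩
  smul_mem' := fun a _ hp => ⟨(L20 R).smul_mem a hp.1, hp.2.smul a⟩

lemma isClosed_meanZeroH1 (R : Set Plane) [IsFiniteMeasure (volume.restrict R)] :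
    IsClosed (meanZeroH1 R : Set (WithLp 2 (L2 R × L2Vec R))) := by
  have h1 : Continuous fun p : WithLp 2 (L2 R × L2Vec R) => p.fst :=
    (WithLp.fstL 2 ℝ (L2 R) (L2Vec R)).continuous
  have h2 : Continuous fun p : WithLp 2 (L2 R × L2Vec R) => p.snd :=
    (WithLp.sndL 2 ℝ (L2 R) (L2Vec R)).continuous
  exact (isClosed_L20.preimage h1).inter
    ((isClosed_setOf_isWeakGradient R).preimage (h1.prodMk h2))

/-- Solution of the Neumann problem by the Lax–Milgram theorem. -/
lemma exists_solution_operator {R : Set Plane} [IsFiniteMeasure (volume.restrict R)]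
    (hR : volume R ≠ 0) (hP : PoincareOn R R) :
    ∃ (G : L2 R →L[ℝ] L2 R) (A : L2 R →L[ℝ] L2Vec R), ∀ r ∈ L20 R, G r ∈ L20 R ∧
      IsWeakGradient R (G r) (A r) ∧
      ∀ (v : L2 R) (h : L2Vec R), IsWeakGradient R v h → inner ℝ (A r) h = inner ℝ r v := by
  obtain ⟨C, hC0, hC⟩ := norm_le_of_poincareOn hP
  have : CompleteSpace (meanZeroH1 R) := (isClosed_meanZeroH1 R).completeSpace_coe
  let J : meanZeroH1 R →L[ℝ] L2 R := (WithLp.fstL 2 ℝ (L2 R) (L2Vec R)).comp (meanZeroH1 R).subtypeL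
  let D : meanZeroH1 R →L[ℝ] L2Vec R :=
    (WithLp.sndL 2 ℝ (L2 R) (L2Vec R)).comp (meanZeroH1 R).subtypeL
  let B : meanZeroH1 R →L[ℝ] meanZeroH1 R →L[ℝ] ℝ := (innerSL ℝ).bilinearComp D D
  have hB : ∀ p q, B p q = inner ℝ (D p) (D q) := fun p q => rfl
  have hcoer : IsCoercive B := by
    -- By Poincaré, the squared norm `‖u‖² + ‖∇u‖²` is at most `(C² + 1) ‖∇u‖²`.
    refine ⟨(C ^ 2 + 1)⁻¹, by positivity, fun p => ?_⟩
    rw [hB, real_inner_self_eq_norm_sq, mul_assoc, inv_mul_le_iff₀ (by positivity), ← sq]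
    have h1 : ‖p‖ ^ 2 = ‖J p‖ ^ 2 + ‖D p‖ ^ 2 :=
      WithLp.prod_norm_sq_eq_of_L2 (p : WithLp 2 (L2 R × L2Vec R))
    have h2 : ‖J p‖ ^ 2 ≤ (C * ‖D p‖) ^ 2 := by
      gcongr
      exact hC _ p.2.1 _ p.2.2
    rw [h1]
    linarith [mul_pow C ‖D p‖ 2]
  -- The adjoint of `J` represents the functional `q ↦ ⟨r, J q⟩`; inverting the form then solves the
  -- weak equation, linearly and continuously in `r`.
  let S : L2 R →L[ℝ] meanZeroH1 R :=
    (hcoer.continuousLinearEquivOfBilin.symm : meanZeroH1 R →L[ℝ] meanZeroH1 R).comp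
      (ContinuousLinearMap.adjoint J)
  have hS : ∀ r q, inner ℝ (D (S r)) (D q) = inner ℝ r (J q) := by
    intro r q
    rw [← hB, ← hcoer.continuousLinearEquivOfBilin_apply]
    change inner ℝ (hcoer.continuousLinearEquivOfBilin
      (hcoer.continuousLinearEquivOfBilin.symm (ContinuousLinearMap.adjoint J r))) q = _
    rw [ContinuousLinearEquiv.apply_symm_apply, ContinuousLinearMap.adjoint_inner_left]
  refine ⟨J.comp S, D.comp S, fun r hr => ⟨(S r).2.1, (S r).2.2, fun v h hv => ?_⟩⟩
  -- Lax–Milgram tests only against functions of mean zero. Subtracting a constant from `v` changes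
  -- neither its gradient nor its product with `r`, which has mean zero.
  obtain ⟨c, hc⟩ := exists_sub_constL2_mem_L20 hR v
  have hw := hv.sub (isWeakGradient_constL2 (R := R) c)
  rw [sub_zero] at hw
  have := hS r ⟨WithLp.toLp 2 (v - constL2 R c, h), hc, hw⟩
  change inner ℝ (D (S r)) h = inner ℝ r (v - constL2 R c) at this
  rw [inner_sub_right, inner_constL2_of_mem_L20 hr, sub_zero] at this
  exact this

/-! ### The Neumann Laplacian, its inverse and the potential. -/

/-- `G r` solves the Neumann problem with right-hand side `r ∈ L²₀(R)`, and `A r` is its weak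
gradient. -/
def IsSolutionOperator (R : Set Plane) (G : L2 R →L[ℝ] L2 R) (A : L2 R →L[ℝ] L2Vec R) : Prop :=
  ∀ r ∈ L20 R, G r ∈ L20 R ∧ IsWeakGradient R (G r) (A r) ∧
    ∀ (v : L2 R) (h : L2Vec R), IsWeakGradient R v h → inner ℝ (A r) h = inner ℝ r v

section Operator

variable {R : Set Plane}

/-- The zero function has only the zero weak gradient, so its image is orthogonal to the dense
`H¹(R)`. This single-valuedness is what makes `Submodule.toLinearPMap` faithful to the graph. -/
lemma neumannGraph_snd_eq_zero (hR : IsOpen R) :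
    ∀ x ∈ neumannGraph R, x.1 = 0 → x.2 = 0 := by
  rintro ⟨u, f⟩ ⟨g, hg, h⟩ rfl
  obtain rfl := hg.eq_zero hR
  refine eq_zero_of_forall_inner_isWeakGradient hR fun v k hv => ?_
  rw [← h v k hv, inner_zero_left]

lemma mem_graph_neumannLaplacian (hR : IsOpen R) {p : L2 R × L2 R} :
    p ∈ (neumannLaplacian R).graph ↔ p ∈ neumannGraph R := by
  rw [neumannLaplacian, Submodule.toLinearPMap_graph_eq _ (neumannGraph_snd_eq_zero hR)]

lemma mem_graph_domRestrict_neumannLaplacian (hR : IsOpen R) {u f : L2 R} :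
    (u, f) ∈ ((neumannLaplacian R).domRestrict (L20 R)).graph ↔
      u ∈ L20 R ∧ (u, f) ∈ neumannGraph R := by
  rw [← mem_graph_neumannLaplacian hR]
  constructor
  · intro h
    obtain ⟨x, hx, hxf⟩ := (LinearPMap.mem_graph_iff _).1 h
    dsimp only at hx hxf
    subst hx
    have hx2 : (x : L2 R) ∈ L20 R ∧ (x : L2 R) ∈ (neumannLaplacian R).domain := x.2
    refine ⟨hx2.1, (LinearPMap.mem_graph_iff _).2 ⟨⟨x, hx2.2⟩, rfl, ?_⟩⟩
    rw [← hxf]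
    exact (LinearPMap.domRestrict_apply (f := neumannLaplacian R) rfl).symm
  · rintro ⟨hu, h⟩
    obtain ⟨x, hx, hxf⟩ := (LinearPMap.mem_graph_iff _).1 h
    dsimp only at hx hxf
    subst hx
    refine (LinearPMap.mem_graph_iff _).2 ⟨⟨x, hu, x.2⟩, rfl, ?_⟩
    rw [← hxf]
    exact LinearPMap.domRestrict_apply (f := neumannLaplacian R) rfl

variable {G : L2 R →L[ℝ] L2 R} {A : L2 R →L[ℝ] L2Vec R}

/-- Testing each equation with the other solution turns both sides into `⟨A r, A q⟩`. -/
lemma IsSolutionOperator.inner_comm (hG : IsSolutionOperator R G A) {r q : L2 R}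
    (hr : r ∈ L20 R) (hq : q ∈ L20 R) : inner ℝ r (G q) = inner ℝ q (G r) := by
  rw [← (hG r hr).2.2 _ _ (hG q hq).2.1, ← (hG q hq).2.2 _ _ (hG r hr).2.1, real_inner_comm]

lemma IsSolutionOperator.inner_pos (hG : IsSolutionOperator R G A) (hR : IsOpen R) {r : L2 R}
    (hr : r ∈ L20 R) (h0 : r ≠ 0) : 0 < inner ℝ r (G r) := by
  obtain ⟨-, h2, h3⟩ := hG r hr
  rw [← h3 _ _ h2, real_inner_self_eq_norm_sq]
  have : A r ≠ 0 := fun hA => h0 <| eq_zero_of_forall_inner_isWeakGradient hR fun v k hv => by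
    rw [← h3 v k hv, hA, inner_zero_left]
  positivity

variable [IsFiniteMeasure (volume.restrict R)]

lemma eq_zero_of_isWeakGradient_zero (hP : PoincareOn R R) {u : L2 R} (hu : u ∈ L20 R)
    (h : IsWeakGradient R u 0) : u = 0 := by
  obtain ⟨C, -, hC⟩ := norm_le_of_poincareOn hP
  have := hC u hu 0 h
  rw [norm_zero, mul_zero] at this
  exact norm_le_zero_iff.1 this

/-- Testing the difference of two solutions against itself makes its gradient vanish; by Poincaré, a
mean-zero function with zero gradient is zero. -/
lemma IsSolutionOperator.eq_apply (hG : IsSolutionOperator R G A) (hP : PoincareOn R R)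
    {r u : L2 R} (hr : r ∈ L20 R) (hu : u ∈ L20 R) {g : L2Vec R} (hg : IsWeakGradient R u g)
    (h : ∀ (v : L2 R) (k : L2Vec R), IsWeakGradient R v k → inner ℝ g k = inner ℝ r v) :
    u = G r := by
  obtain ⟨h1, h2, h3⟩ := hG r hr
  have hd := hg.sub h2
  have h0 : g - A r = 0 := by
    rw [← inner_self_eq_zero (𝕜 := ℝ), inner_sub_left, h _ _ hd, h3 _ _ hd, sub_self]
  rw [h0] at hd
  exact sub_eq_zero.1 (eq_zero_of_isWeakGradient_zero hP ((L20 R).sub_mem hu h1) hd)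

/-- An arbitrary representative `r'` is allowed so that the result covers both `L²` classes and the
pointwise defined residual of a floorplan. -/
lemma IsSolutionOperator.isNeumannPotential_iff (hG : IsSolutionOperator R G A)
    (hP : PoincareOn R R) {r : L2 R} (hr : r ∈ L20 R) {r' : Plane → ℝ}
    (hr' : r =ᵐ[volume.restrict R] r') {φ : L2 R} :
    IsNeumannPotential R r' φ ↔ φ = G r := by
  have hint : ∀ v : L2 R, ∫ x in R, r' x * v x = inner ℝ r v := by
    intro v
    rw [inner_eq_integral_mul]
    refine integral_congr_ae ?_
    filter_upwards [hr'] with x hx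
    rw [hx]
  simp only [IsNeumannPotential, hint, ← L2.inner_def]
  constructor
  · rintro ⟨hφ, g, hg, h⟩
    exact hG.eq_apply hP hr hφ hg h
  · rintro rfl
    obtain ⟨h1, h2, h3⟩ := hG r hr
    exact ⟨h1, A r, h2, h3⟩

lemma IsSolutionOperator.potential_eq (hG : IsSolutionOperator R G A)
    (hP : PoincareOn R R) {r : L2 R} (hr : r ∈ L20 R) {r' : Plane → ℝ}
    (hr' : r =ᵐ[volume.restrict R] r') : potential R r' = G r := by
  have h : ∃ φ, IsNeumannPotential R r' φ := ⟨G r, (hG.isNeumannPotential_iff hP hr hr').2 rfl⟩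
  rw [potential, dif_pos h]
  exact (hG.isNeumannPotential_iff hP hr hr').1 h.choose_spec

lemma IsSolutionOperator.energy_eq (hG : IsSolutionOperator R G A)
    (hP : PoincareOn R R) {r : L2 R} (hr : r ∈ L20 R) {r' : Plane → ℝ}
    (hr' : r =ᵐ[volume.restrict R] r') : energy R r' = 1 / 2 * inner ℝ r (G r) := by
  rw [energy, hG.potential_eq hP hr hr', inner_eq_integral_mul]
  congr 1
  refine integral_congr_ae ?_
  filter_upwards [hr'] with x hx
  rw [hx]

/-- Test against the constant 1, whose gradient is zero: the compatibility condition of the Neumann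
problem. -/
lemma snd_mem_L20_of_mem_neumannGraph {p : L2 R × L2 R} (hp : p ∈ neumannGraph R) :
    p.2 ∈ L20 R := by
  obtain ⟨g, -, h⟩ := hp
  rw [mem_L20_iff, ← h _ _ (isWeakGradient_constL2 1), inner_zero_right]

lemma IsSolutionOperator.mem_neumannGraph_iff (hG : IsSolutionOperator R G A)
    (hP : PoincareOn R R) {u f : L2 R} (hu : u ∈ L20 R) :
    (u, f) ∈ neumannGraph R ↔ f ∈ L20 R ∧ u = G f := by
  constructor
  · intro h
    have hf : f ∈ L20 R := snd_mem_L20_of_mem_neumannGraph h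
    obtain ⟨g, hg, h⟩ := h
    exact ⟨hf, hG.eq_apply hP hf hu hg h⟩
  · rintro ⟨hf, rfl⟩
    exact ⟨A f, (hG f hf).2.1, (hG f hf).2.2⟩

/-- Injectivity is needed for the graph of `LinearPMap.inverse` to be the flipped graph. -/
lemma IsSolutionOperator.ker_domRestrict_eq_bot (hG : IsSolutionOperator R G A) (hR : IsOpen R)
    (hP : PoincareOn R R) :
    LinearMap.ker ((neumannLaplacian R).domRestrict (L20 R)).toFun = ⊥ := by
  rw [LinearMap.ker_eq_bot']
  intro x hx
  have h := LinearPMap.mem_graph ((neumannLaplacian R).domRestrict (L20 R)) x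
  have hx0 : ((neumannLaplacian R).domRestrict (L20 R)) x = 0 := hx
  rw [hx0, mem_graph_domRestrict_neumannLaplacian hR] at h
  have := ((hG.mem_neumannGraph_iff hP h.1).1 h.2).2
  rw [map_zero] at this
  exact Subtype.ext this

lemma IsSolutionOperator.mem_graph_neumannGreen (hG : IsSolutionOperator R G A) (hR : IsOpen R)
    (hP : PoincareOn R R) {u f : L2 R} :
    (f, u) ∈ (neumannGreen R).graph ↔ f ∈ L20 R ∧ u = G f := by
  have h1 : (f, u) ∈ (neumannGreen R).graph ↔
      (u, f) ∈ ((neumannLaplacian R).domRestrict (L20 R)).graph := by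
    rw [neumannGreen, LinearPMap.inverse_graph (hG.ker_domRestrict_eq_bot hR hP)]
    simp
  rw [h1, mem_graph_domRestrict_neumannLaplacian hR]
  constructor
  · rintro ⟨hu, h⟩
    exact (hG.mem_neumannGraph_iff hP hu).1 h
  · rintro ⟨hf, rfl⟩
    exact ⟨(hG f hf).1, (hG.mem_neumannGraph_iff hP (hG f hf).1).2 ⟨hf, rfl⟩⟩

lemma IsSolutionOperator.domain_neumannGreen (hG : IsSolutionOperator R G A) (hR : IsOpen R)
    (hP : PoincareOn R R) : (neumannGreen R).domain = L20 R := by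
  ext f
  rw [LinearPMap.mem_domain_iff]
  simp_rw [hG.mem_graph_neumannGreen hR hP]
  simp

lemma IsSolutionOperator.green_eq (hG : IsSolutionOperator R G A) (hR : IsOpen R)
    (hP : PoincareOn R R) {r : L2 R} (hr : r ∈ L20 R) : green R r = G r := by
  have h : r ∈ (neumannGreen R).domain := by rwa [hG.domain_neumannGreen hR hP]
  rw [green, dif_pos h]
  exact ((hG.mem_graph_neumannGreen hR hP).1 (LinearPMap.mem_graph (neumannGreen R) ⟨r, h⟩)).2

lemma IsSolutionOperator.eq_green_iff (hG : IsSolutionOperator R G A) (hR : IsOpen R)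
    (hP : PoincareOn R R) {r : L2 R} (hr : r ∈ L20 R) {u : L2 R} :
    u = green R r ↔ u ∈ L20 R ∧ ∃ hu : u ∈ (neumannLaplacian R).domain,
      neumannLaplacian R ⟨u, hu⟩ = r := by
  have hgr : (∃ hu : u ∈ (neumannLaplacian R).domain, neumannLaplacian R ⟨u, hu⟩ = r) ↔
      (u, r) ∈ neumannGraph R := by
    rw [← mem_graph_neumannLaplacian hR, LinearPMap.mem_graph_iff]
    constructor
    · rintro ⟨hu, h⟩
      exact ⟨⟨u, hu⟩, rfl, h⟩
    · rintro ⟨⟨x, hx⟩, rfl, h⟩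
      exact ⟨hx, h⟩
  rw [hG.green_eq hR hP hr, hgr]
  constructor
  · rintro rfl
    exact ⟨(hG r hr).1, (hG.mem_neumannGraph_iff hP (hG r hr).1).2 ⟨hr, rfl⟩⟩
  · rintro ⟨hu, h⟩
    exact ((hG.mem_neumannGraph_iff hP hu).1 h).2

end Operator

/-! ### Strict convexity and floorplan residuals. -/

/-- For `a + b = 1`, the convexity defect of `B x x` is exactly `a b B (x - y) (x - y)`. -/
lemma strictConvexOn_of_bilinear {E : Type*} [AddCommGroup E] [Module ℝ E]
    (B : E →ₗ[ℝ] E →ₗ[ℝ] ℝ) (hsymm : ∀ x y, B x y = B y x) (hpos : ∀ x, x ≠ 0 → 0 < B x x) :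
    StrictConvexOn ℝ univ fun x => 1 / 2 * B x x := by
  refine ⟨convex_univ, fun x _ y _ hxy a b ha hb hab => ?_⟩
  have h := hpos (x - y) (sub_ne_zero.2 hxy)
  obtain rfl : b = 1 - a := by linarith
  simp only [map_sub, map_add, map_smul, LinearMap.sub_apply, LinearMap.add_apply,
    LinearMap.smul_apply, smul_eq_mul, hsymm y x] at h ⊢
  nlinarith [mul_pos (mul_pos ha hb) h]

lemma measurableSet_box (s : Fin 2 → ℝ) (c : Plane) : MeasurableSet (box s c) := by
  have : box s c = ⋂ k, {x : Plane | |x k - c k| ≤ s k / 2} := by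
    ext x; simp [box]
  rw [this]
  exact MeasurableSet.iInter fun k =>
    (isClosed_le (by fun_prop) continuous_const).measurableSet

lemma volume_real_box {s : Fin 2 → ℝ} (hs : ∀ k, 0 < s k) (c : Plane) :
    volume.real (box s c) = s 0 * s 1 := by
  have h1 : box s c = (MeasurableEquiv.toLp 2 (Fin 2 → ℝ)).symm ⁻¹'
      Icc (fun k => c k - s k / 2) fun k => c k + s k / 2 := by
    ext x
    simp only [box, mem_preimage, mem_Icc, Pi.le_def, ← forall_and]
    refine forall_congr' fun k => ?_
    rw [abs_le]
    change _ ↔ c k - s k / 2 ≤ x k ∧ x k ≤ c k + s k / 2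
    constructor <;> rintro ⟨h, h'⟩ <;> constructor <;> linarith
  rw [Measure.real, h1,
    (EuclideanSpace.volume_preserving_symm_measurableEquiv_toLp (Fin 2)).measure_preimage
      measurableSet_Icc.nullMeasurableSet, Real.volume_Icc_pi, Fin.prod_univ_two,
    ENNReal.toReal_mul, ENNReal.toReal_ofReal (by linarith [hs 0]),
    ENNReal.toReal_ofReal (by linarith [hs 1])]
  ring

lemma IsBoundedLipschitzDomain.exists_coe_ae_eq_residual {R : Set Plane}
    (hR : IsBoundedLipschitzDomain R) [IsFiniteMeasure (volume.restrict R)] {n : ℕ}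
    {s : Fin n → Fin 2 → ℝ} {c : Fin n → Plane} (hs : ∀ i k, 0 < s i k)
    (hc : ∀ i, box (s i) (c i) ⊆ closure R) :
    ∃ r ∈ L20 R, r =ᵐ[volume.restrict R] residual R s c := by
  have hi : ∀ i, MemLp ((box (s i) (c i)).indicator fun _ => (1 : ℝ)) 2 (volume.restrict R) :=
    fun i => (memLp_const 1).indicator (measurableSet_box _ _)
  have hmem : MemLp (residual R s c) 2 (volume.restrict R) :=
    (memLp_finsetSum Finset.univ fun i _ => hi i).sub (memLp_const _)
  refine ⟨hmem.toLp, ⟨(Lp.memLp _).integrable (by norm_num), ?_⟩, hmem.coeFn_toLp⟩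
  rw [integral_congr_ae hmem.coeFn_toLp]
  have hvol : ∀ i, ∫ x in R, (box (s i) (c i)).indicator (fun _ => (1 : ℝ)) x =
      s i 0 * s i 1 := by
    intro i
    rw [← volume_real_box (hs i) (c i), integral_indicator (measurableSet_box _ _),
      Measure.restrict_restrict (measurableSet_box _ _), setIntegral_const, smul_eq_mul, mul_one]
    refine measureReal_congr ?_
    -- A module lies in the closure of `R`, and off the null boundary this means in `R`;
    -- intersecting with `R` therefore loses no area.
    filter_upwards [measure_eq_zero_iff_ae_notMem.1 hR.volume_frontier] with x hx
    refine propext ⟨fun h => h.1, fun h => ⟨h, ?_⟩⟩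
    rw [hR.isOpen.frontier_eq] at hx
    by_contra hxR
    exact hx ⟨hc i h, hxR⟩
  have hR0 : volume.real R ≠ 0 := by
    rw [measureReal_ne_zero_iff hR.isBounded.measure_lt_top.ne]
    exact (hR.isOpen.measure_pos volume hR.isConnected.nonempty).ne'
  have hint : ∀ i, Integrable ((box (s i) (c i)).indicator fun _ => (1 : ℝ)) (volume.restrict R) :=
    fun i => (hi i).integrable (by norm_num)
  simp only [residual, density]
  rw [integral_sub (integrable_finsetSum _ fun i _ => hint i) (integrable_const _),
    integral_finsetSum _ fun i _ => hint i, setIntegral_const, smul_eq_mul, meanDensity]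
  simp_rw [hvol]
  field_simp
  ring

end PoissonEnergy

theorem mainTheorem11 (R : Set PoissonEnergy.Plane)
    (hR : PoissonEnergy.IsBoundedLipschitzDomain R) :
    -- the Neumann problem is uniquely solvable, so that the potential and the energy make sense
    (∀ r ∈ PoissonEnergy.L20 R, (∃! φ, PoissonEnergy.IsNeumannPotential R r φ) ∧
      PoissonEnergy.IsNeumannPotential R r (PoissonEnergy.potential R r)) ∧
    -- the Green operator is defined on all of `L²₀(R)` and inverts the Neumann Laplacian there
    (PoissonEnergy.neumannGreen R).domain = PoissonEnergy.L20 R ∧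
    (∀ r ∈ PoissonEnergy.L20 R, ∀ u : PoissonEnergy.L2 R,
      u = PoissonEnergy.green R r ↔ u ∈ PoissonEnergy.L20 R ∧
        ∃ hu : u ∈ (PoissonEnergy.neumannLaplacian R).domain,
          PoissonEnergy.neumannLaplacian R ⟨u, hu⟩ = r) ∧
    -- the energy formula for arbitrary residual densities
    (∀ r ∈ PoissonEnergy.L20 R, PoissonEnergy.potential R r = PoissonEnergy.green R r ∧
      PoissonEnergy.energy R r = (1 / 2) * inner ℝ r (PoissonEnergy.green R r)) ∧
    -- the energy formula for floorplans
    (∀ (n : ℕ) (s : Fin n → Fin 2 → ℝ) (c : Fin n → PoissonEnergy.Plane),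
      (∀ i k, 0 < s i k) → (∀ i, PoissonEnergy.box (s i) (c i) ⊆ closure R) →
      ∃ r ∈ PoissonEnergy.L20 R,
        r =ᵐ[volume.restrict R] PoissonEnergy.residual R s c ∧
        PoissonEnergy.potential R (PoissonEnergy.residual R s c) = PoissonEnergy.green R r ∧
        PoissonEnergy.floorplanEnergy R s c = (1 / 2) * inner ℝ r (PoissonEnergy.green R r)) ∧
    -- the energy is a positive definite quadratic form and strictly convex on `L²₀(R)`
    (∃ Q : QuadraticForm ℝ (PoissonEnergy.L20 R),
      (∀ r : PoissonEnergy.L20 R, Q r = PoissonEnergy.energy R (r : PoissonEnergy.L2 R)) ∧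
        Q.PosDef) ∧
    StrictConvexOn ℝ Set.univ
      (fun r : PoissonEnergy.L20 R => PoissonEnergy.energy R (r : PoissonEnergy.L2 R)) ∧
    -- the first variation of the energy at `r` is the potential of `r`
    (∀ r : PoissonEnergy.L20 R, ∃ D : PoissonEnergy.L20 R →L[ℝ] ℝ,
      HasFDerivAt
        (fun q : PoissonEnergy.L20 R => PoissonEnergy.energy R (q : PoissonEnergy.L2 R)) D r ∧
      ∀ η : PoissonEnergy.L20 R,
        D η = ∫ x in R, PoissonEnergy.potential R (r : PoissonEnergy.L2 R) x *
          (η : PoissonEnergy.L2 R) x) ∧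
    -- the potential is smoother than `r`: it gains one weak derivative, with a uniform bound
    (∃ C : ℝ, ∀ r ∈ PoissonEnergy.L20 R, ∃ g : PoissonEnergy.L2Vec R,
      PoissonEnergy.IsWeakGradient R (PoissonEnergy.green R r) g ∧
        ‖PoissonEnergy.green R r‖ + ‖g‖ ≤ C * ‖r‖) := by
  have hfin := PoissonEnergy.isFiniteMeasure_restrict hR.isBounded
  have hRo := hR.isOpen
  have hP := hR.poincareOn
  obtain ⟨G, A, hG'⟩ := PoissonEnergy.exists_solution_operator
    (hRo.measure_pos volume hR.isConnected.nonempty).ne' hP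
  have hG : PoissonEnergy.IsSolutionOperator R G A := hG'
  have hpot : ∀ r ∈ PoissonEnergy.L20 R, PoissonEnergy.potential R r = G r := fun r hr =>
    hG.potential_eq hP hr (.refl _ _)
  have hen : ∀ r ∈ PoissonEnergy.L20 R, PoissonEnergy.energy R r = 1 / 2 * inner ℝ r (G r) :=
    fun r hr => hG.energy_eq hP hr (.refl _ _)
  have hgreen : ∀ r ∈ PoissonEnergy.L20 R, PoissonEnergy.green R r = G r := fun r hr =>
    hG.green_eq hRo hP hr
  -- The bounded bilinear form `⟨r, G q⟩`, whose half diagonal is the energy.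
  let B : PoissonEnergy.L20 R →L[ℝ] PoissonEnergy.L20 R →L[ℝ] ℝ :=
    (innerSL ℝ).bilinearComp (PoissonEnergy.L20 R).subtypeL (G.comp (PoissonEnergy.L20 R).subtypeL)
  have hB : ∀ r q : PoissonEnergy.L20 R, B r q = inner ℝ (r : PoissonEnergy.L2 R) (G q) :=
    fun r q => rfl
  have hBs : ∀ r q, B r q = B q r := fun r q => by
    rw [hB, hB, hG.inner_comm r.2 q.2]
  have hBp : ∀ r, r ≠ 0 → 0 < B r r := fun r hr =>
    hG.inner_pos hRo r.2 fun h => hr (Subtype.ext h)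
  have hEB : (fun r : PoissonEnergy.L20 R => PoissonEnergy.energy R (r : PoissonEnergy.L2 R)) =
      fun r => 1 / 2 * B r r := funext fun r => hen r r.2
  refine ⟨fun r hr => ⟨⟨G r, (hG.isNeumannPotential_iff hP hr (.refl _ _)).2 rfl,
      fun φ hφ => (hG.isNeumannPotential_iff hP hr (.refl _ _)).1 hφ⟩,
      (hG.isNeumannPotential_iff hP hr (.refl _ _)).2 (hpot r hr)⟩,
    hG.domain_neumannGreen hRo hP, fun r hr u => hG.eq_green_iff hRo hP hr,
    fun r hr => ⟨by rw [hpot r hr, hgreen r hr], by rw [hen r hr, hgreen r hr]⟩,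
    fun n s c hs hc => ?_, ?_, ?_, fun r => ?_, ?_⟩
  · obtain ⟨r, hr, hrr⟩ := hR.exists_coe_ae_eq_residual hs hc
    refine ⟨r, hr, hrr, ?_, ?_⟩
    · rw [hG.potential_eq hP hr hrr, hgreen r hr]
    · rw [PoissonEnergy.floorplanEnergy, hG.energy_eq hP hr hrr, hgreen r hr]
  · refine ⟨(1 / 2 : ℝ) • B.toBilinForm.toQuadraticMap, fun r => ?_, fun r hr => ?_⟩
    · rw [hen r r.2]
      rfl
    · exact mul_pos (by norm_num) (hBp r hr)
  · rw [hEB]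
    exact PoissonEnergy.strictConvexOn_of_bilinear B.toBilinForm hBs hBp
  · refine ⟨B r, ?_, fun η => ?_⟩
    · rw [hEB]
      have h1 := (B.hasFDerivAt (x := r)).clm_apply (hasFDerivAt_id r)
      -- The product rule gives `(B r η + B η r) / 2`, which symmetry reduces to `B r η`.
      refine (h1.const_mul (1 / 2)).congr_fderiv ?_
      ext η
      change 1 / 2 * (B r η + B η r) = B r η
      rw [hBs η r]
      ring
    · rw [hBs, hB, hpot r r.2, real_inner_comm, PoissonEnergy.inner_eq_integral_mul]
  · refine ⟨‖G‖ + ‖A‖, fun r hr => ⟨A r, ?_, ?_⟩⟩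
    · rw [hgreen r hr]
      exact (hG r hr).2.1
    · rw [hgreen r hr, add_mul]
      exact add_le_add (G.le_opNorm r) (A.le_opNorm r)
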